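/- **Conventions.** $\mathbb R^4_1$ is $\mathbb R^4$ with $\langle x,y\rangle=x_1y_1+x_2y_2+x_3y_3-x_4y_4$ and its standard orientation; a *motion* is an orientation-preserving affine isometry of it; *smooth* means $C^\infty$; $\Delta^h=\partial^2/\partial u^2-\partial^2/\partial v^2$. A smooth parametrized surface $z=z(u,v)$ in $\mathbb R^4_1$ is considered with first fundamental form $E,F,G$ and with $E<0<G$ (so it is timelike); $\sigma$ is its second fundamental tensor, $D$ its normal connection, $R^\perp(X,Y)=D_XD_Y-D_YD_X-D_{[X,Y]}$, and $H=\frac12\operatorname{tr}\sigma$. A point is *flat* if the vectors $\sigma(X,Y)$ ($X,Y$ tangent) span a space of dimension at most one. For such a surface with $H=0$ and without flat points, the parameters $(u,v)$ are *canonical* if $F=0$ and, with $x=z_u/\sqrt{-E}$, $y=z_v/\sqrt G$, there are a smooth orthonormal frame field $n_1,n_2$ of the normal bundle with $(x,y,n_1,n_2)$ positively oriented, and functions $\nu,\mu$, such that $$\sigma(x,x)=\sigma(y,y)=\nu n_1,\qquad \sigma(x,y)=\mu n_2,\qquad E=-\frac1{\sqrt{\mu^2+\nu^2}},\qquad G=\frac1{\sqrt{\mu^2+\nu^2}}.$$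 The curvatures are taken with the sign conventions $$K=\langle\sigma(x,x),\sigma(y,y)\rangle-\langle\sigma(x,y),\sigma(x,y)\rangle,\qquad \varkappa=\langle R^\perp(x,y)n_2,n_1\rangle .$$ **Theorem.** (i) Let $z$ be a timelike surface with zero mean curvature, free of flat points, over an open set $\mathcal D\subset\mathbb R^2$, and let $(u,v)$ be canonical parameters. Then $K$ and $\varkappa$ are smooth, $\varkappa$ vanishes nowhere, $$(K^2+\varkappa^2)^{1/4}\,\Delta^h\ln(K^2+\varkappa^2)^{1/8}=K \quad\text{on } \mathcal D,$$ and $$(K^2+\varkappa^2)^{1/4}\,\Delta^h\arctan\frac{\varkappa}{K}=2\varkappa\quad\text{at every point of } \mathcal D \text{ where } K\neq0 .$$ (ii) Conversely, let $\mathcal D\subset\mathbb R^2$ be a domain (open, connected, nonempty) and let $K,\varkappa$ be smooth functions on $\mathcal D$, neither of which vanishes anywhere, satisfying both equations on $\mathcal D$. Then every point of $\mathcal D$ lies in a subdomain $\mathcal D_0\subset\mathcal D$ over which there is a timelike surface with zero mean curvature, free of flat points, whose Gauss curvature and normal curvature are $K$ and $\varkappa$ and for which $(u,v)$ are canonical parameters.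 Moreover, over any subdomain $\mathcal D_0\subset\mathcal D$, any two such surfaces $z,z'$ differ by a motion: $z'=\varphi\circ z$ on $\mathcal D_0$ for some motion $\varphi$ of $\mathbb R^4_1$. -/

import Mathlib

open scoped ContDiff

noncomputable section

namespace TimelikeZMC

/-- The space `ℝ⁴₁`, in the coordinates of a fixed orthonormal system `e₁ e₂ e₃ e₄`. -/
abbrev R41 : Type := Fin 4 → ℝ

/-- The Minkowski metric `x₁y₁ + x₂y₂ + x₃y₃ - x₄y₄` of signature `(3,1)`. -/
def mink (a b : R41) : ℝ := a 0 * b 0 + a 1 * b 1 + a 2 * b 2 - a 3 * b 3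

/-- Motions of `ℝ⁴₁`: orientation preserving affine isometries of the Minkowski metric. -/
def IsMotion (φ : R41 → R41) : Prop :=
  ∃ (L : R41 →ₗ[ℝ] R41) (c : R41), (∀ a b, mink (L a) (L b) = mink a b) ∧
    LinearMap.det L = 1 ∧ ∀ x, φ x = L x + c

/-- Partial derivative in the first variable `u`. -/
def du {V : Type*} [NormedAddCommGroup V] [NormedSpace ℝ V] (f : ℝ × ℝ → V) (p : ℝ × ℝ) : V :=
  fderiv ℝ f p (1, 0)

/-- Partial derivative in the second variable `v`. -/
def dv {V : Type*} [NormedAddCommGroup V] [NormedSpace ℝ V] (f : ℝ × ℝ → V) (p : ℝ × ℝ) : V :=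
  fderiv ℝ f p (0, 1)

/-- The hyperbolic Laplace operator `∂²/∂u² - ∂²/∂v²`. -/
def hypLaplace (f : ℝ × ℝ → ℝ) (p : ℝ × ℝ) : ℝ := du (du f) p - dv (dv f) p

/-! Geometry of a parametrized surface `z = z(u,v)` in `ℝ⁴₁`. Tangent vectors of the surface at
`z(p)` are given by their coordinates in the basis `z_u, z_v`, that is, by elements of `ℝ × ℝ`. -/

/-- Coefficient `E` of the first fundamental form. -/
def EE (z : ℝ × ℝ → R41) (p : ℝ × ℝ) : ℝ := mink (du z p) (du z p)

/-- Coefficient `F` of the first fundamental form. -/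
def FF (z : ℝ × ℝ → R41) (p : ℝ × ℝ) : ℝ := mink (du z p) (dv z p)

/-- Coefficient `G` of the first fundamental form. -/
def GG (z : ℝ × ℝ → R41) (p : ℝ × ℝ) : ℝ := mink (dv z p) (dv z p)

/-- The component of `w` in the tangent plane `span {z_u, z_v}` (which is nondegenerate when
`EG - F² ≠ 0`) with respect to the orthogonal decomposition of `ℝ⁴₁`. -/
def tangentPart (z : ℝ × ℝ → R41) (p : ℝ × ℝ) (w : R41) : R41 :=
  ((GG z p * mink w (du z p) - FF z p * mink w (dv z p)) /
      (EE z p * GG z p - FF z p ^ 2)) • du z p +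
    ((EE z p * mink w (dv z p) - FF z p * mink w (du z p)) /
      (EE z p * GG z p - FF z p ^ 2)) • dv z p

/-- The component of `w` in the normal plane. -/
def normalPart (z : ℝ × ℝ → R41) (p : ℝ × ℝ) (w : R41) : R41 := w - tangentPart z p w

/-- The second fundamental tensor `σ(a,b)`: the normal component of the second derivative of `z`
in the directions `a` and `b`. -/
def sff (z : ℝ × ℝ → R41) (p : ℝ × ℝ) (a b : ℝ × ℝ) : R41 :=
  normalPart z p (fderiv ℝ (fun q => fderiv ℝ z q b) p a)

/-- A smooth parametrized timelike surface, with `z_u` timelike and `z_v` spacelike. -/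
structure IsTimelikeSurface (z : ℝ × ℝ → R41) (D : Set (ℝ × ℝ)) : Prop where
  smooth : ContDiffOn ℝ ∞ z D
  E_neg : ∀ p ∈ D, EE z p < 0
  G_pos : ∀ p ∈ D, 0 < GG z p

/-- The mean curvature vector `H = ½ tr σ`, the trace being taken with respect to the induced
metric; it is `½ (-σ(x,x) + σ(y,y))` in an orthonormal frame with `x` timelike. -/
def meanCurvature (z : ℝ × ℝ → R41) (p : ℝ × ℝ) : R41 :=
  (1 / (2 * (EE z p * GG z p - FF z p ^ 2))) •
    (GG z p • sff z p (1, 0) (1, 0) - (2 * FF z p) • sff z p (1, 0) (0, 1)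
      + EE z p • sff z p (0, 1) (0, 1))

/-- `e₁, e₂` is an orthonormal basis of the normal plane at `z(p)`. -/
structure IsNormalBasis (z : ℝ × ℝ → R41) (p : ℝ × ℝ) (e₁ e₂ : R41) : Prop where
  normal₁u : mink e₁ (du z p) = 0
  normal₁v : mink e₁ (dv z p) = 0
  normal₂u : mink e₂ (du z p) = 0
  normal₂v : mink e₂ (dv z p) = 0
  unit₁ : mink e₁ e₁ = 1
  unit₂ : mink e₂ e₂ = 1
  orth : mink e₁ e₂ = 0

/-- `p` is a flat point: with `c_{ij}^k = ⟨z_{ij}, e_k⟩` for an orthonormal basis `e₁, e₂` of the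
normal plane, the determinants `Δ₁, Δ₂, Δ₃` of the pairs `(c₁₁, c₁₂)`, `(c₁₁, c₂₂)`, `(c₁₂, c₂₂)`
all vanish (for one basis or, equivalently, for all). -/
def IsFlatPoint (z : ℝ × ℝ → R41) (p : ℝ × ℝ) : Prop :=
  ∀ e₁ e₂ : R41, IsNormalBasis z p e₁ e₂ →
    mink (du (du z) p) e₁ * mink (du (dv z) p) e₂
        - mink (du (dv z) p) e₁ * mink (du (du z) p) e₂ = 0 ∧
    mink (du (du z) p) e₁ * mink (dv (dv z) p) e₂
        - mink (dv (dv z) p) e₁ * mink (du (du z) p) e₂ = 0 ∧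
    mink (du (dv z) p) e₁ * mink (dv (dv z) p) e₂
        - mink (dv (dv z) p) e₁ * mink (du (dv z) p) e₂ = 0

/-- The Gauss curvature, with the sign convention
`K = ⟨σ(x,x), σ(y,y)⟩ - ⟨σ(x,y), σ(x,y)⟩` for an orthonormal tangent frame `x, y`
(`x` timelike, `y` spacelike), written in arbitrary parameters. -/
def gaussCurvature (z : ℝ × ℝ → R41) (p : ℝ × ℝ) : ℝ :=
  (mink (sff z p (1, 0) (1, 0)) (sff z p (0, 1) (0, 1))
      - mink (sff z p (1, 0) (0, 1)) (sff z p (1, 0) (0, 1))) /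
    (FF z p ^ 2 - EE z p * GG z p)

/-- The normal connection `D_X ξ`: the normal component of the derivative of the normal field `ξ`
along the tangent field `X`. -/
def normalConn (z : ℝ × ℝ → R41) (X : ℝ × ℝ → ℝ × ℝ) (ξ : ℝ × ℝ → R41) (p : ℝ × ℝ) : R41 :=
  normalPart z p (fderiv ℝ ξ p (X p))

/-- The normal curvature operator `R^⊥(X,Y) ξ = D_X D_Y ξ - D_Y D_X ξ - D_{[X,Y]} ξ`. -/
def normalCurvatureOp (z : ℝ × ℝ → R41) (X Y : ℝ × ℝ → ℝ × ℝ) (ξ : ℝ × ℝ → R41)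
    (p : ℝ × ℝ) : R41 :=
  normalConn z X (normalConn z Y ξ) p - normalConn z Y (normalConn z X ξ) p
    - normalConn z (VectorField.lieBracket ℝ X Y) ξ p

/-- The normal curvature `ϰ = ⟨R^⊥(x,y) n₂, n₁⟩`, where `x, y` is an orthonormal tangent frame
oriented like `z_u, z_v`. As `R^⊥` is tensorial and alternating,
`R^⊥(x,y) = R^⊥(z_u,z_v) / √(F² - EG)`. -/
def normalCurvature (z n₁ n₂ : ℝ × ℝ → R41) (p : ℝ × ℝ) : ℝ :=
  mink (normalCurvatureOp z (fun _ => (1, 0)) (fun _ => (0, 1)) n₂ p) (n₁ p) /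
    Real.sqrt (FF z p ^ 2 - EE z p * GG z p)

/-- `n₁, n₂` is a smooth orthonormal frame field of the normal bundle such that
`z_u, z_v, n₁, n₂` is positively oriented in `ℝ⁴₁`. -/
structure IsNormalFrame (z : ℝ × ℝ → R41) (D : Set (ℝ × ℝ)) (n₁ n₂ : ℝ × ℝ → R41) : Prop where
  smooth₁ : ContDiffOn ℝ ∞ n₁ D
  smooth₂ : ContDiffOn ℝ ∞ n₂ D
  basis : ∀ p ∈ D, IsNormalBasis z p (n₁ p) (n₂ p)
  oriented : ∀ p ∈ D, 0 < Matrix.det (Matrix.of ![du z p, dv z p, n₁ p, n₂ p])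

/-- The unit tangent vector `x = z_u / √(-E)`. -/
def unitX (z : ℝ × ℝ → R41) (p : ℝ × ℝ) : ℝ × ℝ := (1 / Real.sqrt (-EE z p), 0)

/-- The unit tangent vector `y = z_v / √G`. -/
def unitY (z : ℝ × ℝ → R41) (p : ℝ × ℝ) : ℝ × ℝ := (0, 1 / Real.sqrt (GG z p))

/-- The parameters `(u,v)` are semi-canonical: the parametric lines are orthogonal, and
`x = z_u/√(-E)`, `y = z_v/√G` together with `n₁, n₂` form the geometric frame field
`σ(x,x) = ν n₁`, `σ(x,y) = μ n₂`, `σ(y,y) = ν n₁`, with geometric functions `ν` and `μ`. -/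
structure IsSemiCanonical (z : ℝ × ℝ → R41) (D : Set (ℝ × ℝ)) (n₁ n₂ : ℝ × ℝ → R41)
    (ν μ : ℝ × ℝ → ℝ) : Prop where
  frame : IsNormalFrame z D n₁ n₂
  F_zero : ∀ p ∈ D, FF z p = 0
  sff_xx : ∀ p ∈ D, sff z p (unitX z p) (unitX z p) = ν p • n₁ p
  sff_xy : ∀ p ∈ D, sff z p (unitX z p) (unitY z p) = μ p • n₂ p
  sff_yy : ∀ p ∈ D, sff z p (unitY z p) (unitY z p) = ν p • n₁ p

/-- The parameters `(u,v)` are canonical: semi-canonical with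
`E = -1/√(μ²+ν²)`, `F = 0`, `G = 1/√(μ²+ν²)`. -/
structure IsCanonical (z : ℝ × ℝ → R41) (D : Set (ℝ × ℝ)) (n₁ n₂ : ℝ × ℝ → R41)
    (ν μ : ℝ × ℝ → ℝ) : Prop extends IsSemiCanonical z D n₁ n₂ ν μ where
  E_eq : ∀ p ∈ D, EE z p = -(1 / Real.sqrt (μ p ^ 2 + ν p ^ 2))
  G_eq : ∀ p ∈ D, GG z p = 1 / Real.sqrt (μ p ^ 2 + ν p ^ 2)

/-- `z` is, over `D`, a timelike surface with zero mean curvature free of flat points, `(u,v)` are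
canonical parameters of it, and `n₁, n₂` is the normal part of its geometric frame field. -/
structure IsCanonicalZMCSurface (z : ℝ × ℝ → R41) (D : Set (ℝ × ℝ)) (n₁ n₂ : ℝ × ℝ → R41) :
    Prop where
  timelike : IsTimelikeSurface z D
  zero_mean : ∀ p ∈ D, meanCurvature z p = 0
  no_flat : ∀ p ∈ D, ¬ IsFlatPoint z p
  canonical : ∃ ν μ : ℝ × ℝ → ℝ, IsCanonical z D n₁ n₂ ν μ

/-- First natural equation `(K²+ϰ²)^{1/4} Δʰ ln (K²+ϰ²)^{1/8} = K` at `p`. -/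
def NaturalEq₁ (K ϰ : ℝ × ℝ → ℝ) (p : ℝ × ℝ) : Prop :=
  (K p ^ 2 + ϰ p ^ 2) ^ (1 / 4 : ℝ) *
    hypLaplace (fun q => Real.log ((K q ^ 2 + ϰ q ^ 2) ^ (1 / 8 : ℝ))) p = K p

/-- Second natural equation `(K²+ϰ²)^{1/4} Δʰ arctan (ϰ/K) = 2ϰ` at `p`. -/
def NaturalEq₂ (K ϰ : ℝ × ℝ → ℝ) (p : ℝ × ℝ) : Prop :=
  (K p ^ 2 + ϰ p ^ 2) ^ (1 / 4 : ℝ) *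
    hypLaplace (fun q => Real.arctan (ϰ q / K q)) p = 2 * ϰ p

end TimelikeZMC

end

/-! Write λ = G = -E. The frame X = (z_u, z_v, n₁, n₂) has Gram matrix diag(-λ, λ, 1, 1), and in
canonical parameters it satisfies a linear system X_u = U X, X_v = V X. Its coefficients are built
from λ, ν, μ, a = λ_u/2λ, b = λ_v/2λ and the components β₁, β₂ of the normal connection.

Since λ²(ν² + μ²) = 1, locally λν = cos θ and λμ = sin θ. Compatibility of the system then splits
into Codazzi: θ_u = β₂, θ_v = β₁; closedness: a_v = b_u; Gauss: a_u - b_v = λ(μ² - ν²); Ricci: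
(β₂)_u - (β₁)_v = 2λμν. On the other hand K = ν² - μ² and ϰ = -2νμ, that is, λ²(K + iϰ) = exp(-2iθ).
Hence (K² + ϰ²)^{1/4} = 1/λ, the logarithm in the first natural equation is -½ ln λ, and arctan(ϰ/K)
is locally -2θ plus a constant. So the two natural equations are the Gauss and Ricci equations
(`naturalEq₁_iff`, `naturalEq₂_iff`). A point is flat exactly when νμ = 0, so ϰ has no zeros.

For the converse, K and ϰ determine λ, and they determine (ν, μ) up to a common sign, as a square
root of K + iϰ; since ϰ ≠ 0 this root can be chosen smoothly (`exists_frameData`). The natural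
equations make the linear system integrable, and a Frobenius theorem
(`exists_solution_of_integrable`) yields the frame and the surface. The operator carrying one
solution frame to another is locally constant (`IsSolution.hasPartials_transition`). Applied to a
frame and itself, this shows that the Gram relations persist; applied to two surfaces, it gives the
motion relating them. The remaining sign ambiguity is the change (n₁, n₂) ↦ (-n₁, -n₂), which
preserves orientation. -/

namespace TimelikeZMC

/-! ### Completely integrable linear systems in two variables. -/

section Frobenius

open Set Metric Filter Topology

variable {E : Type*} [NormedAddCommGroup E] [NormedSpace ℝ E]

/-- On an interval so short that C t ≤ 1/2, the exponential factor is at most exp(1/2) ≤ 1/(1 - 1/2)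
= 2, which gives Grönwall a constant independent of C. -/
theorem gronwallBound_le_of_mul_le_half {C δ η ε t : ℝ} (hC : 1 ≤ C) (hCδ : C * δ ≤ 1 / 2)
    (hη : 0 ≤ η) (hε : 0 ≤ ε) (htδ : t ≤ δ) (ht : 0 ≤ t) :
    gronwallBound η C ε t ≤ 2 * (η + ε) := by
  have hC0 : C ≠ 0 := by positivity
  rw [gronwallBound_of_K_ne_0 hC0]
  have h1 : Real.exp (C * t) ≤ 2 := by
    have h2 : C * t ≤ 1 / 2 := le_trans (by gcongr) hCδ
    have h3 : Real.exp (1 / 2) ≤ 2 := by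
      have := Real.exp_bound_div_one_sub_of_interval (x := 1 / 2) (by norm_num) (by norm_num)
      norm_num at this ⊢
      exact this
    exact (Real.exp_le_exp.2 h2).trans h3
  have h4 : ε / C ≤ ε := div_le_self hε hC
  have h5 : 0 ≤ Real.exp (C * t) - 1 := by
    have : (1 : ℝ) ≤ Real.exp (C * t) := Real.one_le_exp (by positivity)
    linarith
  have h6 : ε / C * (Real.exp (C * t) - 1) ≤ ε * (2 - 1) := by
    gcongr
  nlinarith

/-- A two-sided Grönwall estimate on a short interval. -/
theorem norm_le_of_norm_deriv_le_of_short {C δ ε t₀ : ℝ} {f f' : ℝ → E} (hC : 1 ≤ C)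
    (hCδ : C * δ ≤ 1 / 2) (hε : 0 ≤ ε)
    (hf : ∀ t ∈ Icc (t₀ - δ) (t₀ + δ), HasDerivWithinAt f (f' t) (Icc (t₀ - δ) (t₀ + δ)) t)
    (hb : ∀ t ∈ Icc (t₀ - δ) (t₀ + δ), ‖f' t‖ ≤ C * ‖f t‖ + ε) :
    ∀ t ∈ Icc (t₀ - δ) (t₀ + δ), ‖f t‖ ≤ 2 * (‖f t₀‖ + ε) := by
  have key : ∀ g g' : ℝ → E,
      (∀ t ∈ Icc (t₀ - δ) (t₀ + δ), HasDerivWithinAt g (g' t) (Icc (t₀ - δ) (t₀ + δ)) t) →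
      (∀ t ∈ Icc (t₀ - δ) (t₀ + δ), ‖g' t‖ ≤ C * ‖g t‖ + ε) →
      ∀ t ∈ Icc t₀ (t₀ + δ), ‖g t‖ ≤ 2 * (‖g t₀‖ + ε) := by
    intro g g' hg hgb t ht
    have hδ : 0 ≤ δ := by linarith [ht.1, ht.2]
    have hsub : Icc t₀ (t₀ + δ) ⊆ Icc (t₀ - δ) (t₀ + δ) := Icc_subset_Icc (by linarith) le_rfl
    have := norm_le_gronwallBound_of_norm_deriv_right_le (f := g) (f' := g') (δ := ‖g t₀‖)
      (K := C) (ε := ε) (a := t₀) (b := t₀ + δ)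
      (fun s hs => ((hg s (hsub hs)).continuousWithinAt).mono hsub)
      (fun s hs => by
        have hs' : s ∈ Icc (t₀ - δ) (t₀ + δ) := hsub (Ico_subset_Icc_self hs)
        refine (hg s hs').mono_of_mem_nhdsWithin ?_
        refine mem_of_superset (Icc_mem_nhdsGE hs.2) ?_
        exact Icc_subset_Icc hs'.1 le_rfl)
      le_rfl (fun s hs => hgb s (hsub (Ico_subset_Icc_self hs))) t ht
    exact this.trans (gronwallBound_le_of_mul_le_half hC hCδ (norm_nonneg _) hε
      (by linarith [ht.2]) (by linarith [ht.1]))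
  intro t ht
  rcases le_total t₀ t with h | h
  · exact key f f' hf hb t ⟨h, ht.2⟩
  -- The left half of the interval is reduced to the right half by the reflection s ↦ 2 t₀ - s.
  · have hmaps : MapsTo (fun s => 2 * t₀ - s) (Icc (t₀ - δ) (t₀ + δ)) (Icc (t₀ - δ) (t₀ + δ)) := by
      intro s hs
      exact ⟨by simp only; linarith [hs.2], by simp only; linarith [hs.1]⟩
    have := key (fun s => f (2 * t₀ - s)) (fun s => -f' (2 * t₀ - s))
      (fun s hs => by
        have h1 : HasDerivWithinAt (fun s => 2 * t₀ - s) (-1) (Icc (t₀ - δ) (t₀ + δ)) s :=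
          ((hasDerivAt_id s).const_sub (2 * t₀)).hasDerivWithinAt
        simpa [Function.comp_def] using (hf _ (hmaps hs)).scomp s h1 hmaps)
      (fun s hs => by simpa using hb _ (hmaps hs)) (2 * t₀ - t)
      ⟨by linarith, by linarith [ht.1]⟩
    simp only [sub_sub_cancel] at this
    convert this using 4
    ring_nf

theorem exists_linear_ode_of_short [CompleteSpace E] {C δ t₀ : ℝ} {M : ℝ → E →L[ℝ] E}
    (hC : 1 ≤ C) (hδ : 0 < δ)
    (hCδ : C * δ ≤ 1 / 2) (hM : ContinuousOn M (Icc (t₀ - δ) (t₀ + δ)))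
    (hb : ∀ t ∈ Icc (t₀ - δ) (t₀ + δ), ‖M t‖ ≤ C) (x : E) :
    ∃ f : ℝ → E, f t₀ = x ∧ ∀ t ∈ Icc (t₀ - δ) (t₀ + δ),
      HasDerivWithinAt f (M t (f t)) (Icc (t₀ - δ) (t₀ + δ)) t := by
  have ht₀ : t₀ ∈ Icc (t₀ - δ) (t₀ + δ) := ⟨by linarith, by linarith⟩
  have hC0 : 0 ≤ C := by linarith
  -- On the ball of radius ‖x‖ + 1 around x the field is bounded by C (2‖x‖ + 1). Since C δ ≤ 1/2, a
  -- solution cannot leave this ball before time δ, so it lives on the whole interval.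
  have hPL : IsPicardLindelof (fun t y => M t y) (⟨t₀, ht₀⟩ : Icc (t₀ - δ) (t₀ + δ)) x
      (‖x‖₊ + 1) 0 (⟨C, hC0⟩ * (2 * ‖x‖₊ + 1)) ⟨C, hC0⟩ := by
    refine ⟨fun t ht => ?_, fun y _ => hM.clm_apply continuousOn_const, fun t ht y hy => ?_, ?_⟩
    · refine LipschitzWith.lipschitzOnWith ((M t).lipschitz.weaken ?_)
      exact_mod_cast hb t ht
    · have h1 : ‖y‖ ≤ 2 * ‖x‖ + 1 := by
        have h2 : ‖y - x‖ ≤ ‖x‖ + 1 := by simpa [mem_closedBall, dist_eq_norm] using hy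
        have h3 : ‖y‖ ≤ ‖y - x‖ + ‖x‖ := by simpa using norm_add_le (y - x) x
        linarith
      calc ‖M t y‖ ≤ ‖M t‖ * ‖y‖ := (M t).le_opNorm y
        _ ≤ C * (2 * ‖x‖ + 1) := by gcongr; exact hb t ht
    · simp only [add_sub_cancel_left, sub_sub_cancel, max_self]
      push_cast
      have : (0 : ℝ) ≤ ‖x‖ := norm_nonneg x
      change C * (2 * ‖x‖ + 1) * δ ≤ ‖x‖ + 1 - 0
      nlinarith
  exact hPL.exists_eq_forall_mem_Icc_hasDerivWithinAt₀

/-- The square of side `2 δ` around `p`. -/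
def square (p : ℝ × ℝ) (δ : ℝ) : Set (ℝ × ℝ) :=
  Icc (p.1 - δ) (p.1 + δ) ×ˢ Icc (p.2 - δ) (p.2 + δ)

theorem closedBall_eq_square (p : ℝ × ℝ) (δ : ℝ) : closedBall p δ = square p δ := by
  rw [square, ← Real.closedBall_eq_Icc, ← Real.closedBall_eq_Icc, closedBall_prod_same]

/-- Quantitative first order control in the variable `u`, on a square, of the coefficients of a
linear system, uniform in `v`. -/
structure IsControlled (B : ℝ × ℝ → E →L[ℝ] E) (p₀ : ℝ × ℝ) (δ C : ℝ) : Prop where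
  bound : ∀ p ∈ square p₀ δ, ‖B p‖ ≤ C
  bound_du : ∀ p ∈ square p₀ δ, ‖du B p‖ ≤ C
  lipschitz : ∀ u u' v, (u, v) ∈ square p₀ δ → (u', v) ∈ square p₀ δ →
    ‖B (u', v) - B (u, v)‖ ≤ C * |u' - u|
  taylor : ∀ u u' v, (u, v) ∈ square p₀ δ → (u', v) ∈ square p₀ δ →
    ‖B (u', v) - B (u, v) - (u' - u) • du B (u, v)‖ ≤ C * |u' - u| ^ 2

theorem IsControlled.mono {B : ℝ × ℝ → E →L[ℝ] E} {p₀ : ℝ × ℝ} {δ δ' C C' : ℝ}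
    (h : IsControlled B p₀ δ C) (hδ : δ' ≤ δ) (hC : C ≤ C') : IsControlled B p₀ δ' C' := by
  have hs : square p₀ δ' ⊆ square p₀ δ := by
    rw [← closedBall_eq_square, ← closedBall_eq_square]
    exact closedBall_subset_closedBall hδ
  exact ⟨fun p hp => (h.bound p (hs hp)).trans hC, fun p hp => (h.bound_du p (hs hp)).trans hC,
    fun u u' v h1 h2 => (h.lipschitz u u' v (hs h1) (hs h2)).trans (by gcongr),
    fun u u' v h1 h2 => (h.taylor u u' v (hs h1) (hs h2)).trans (by gcongr)⟩

theorem hasDerivAt_fst {V : Type*} [NormedAddCommGroup V] [NormedSpace ℝ V] {f : ℝ × ℝ → V}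
    {u v : ℝ} (h : DifferentiableAt ℝ f (u, v)) :
    HasDerivAt (fun t => f (t, v)) (du f (u, v)) u :=
  HasFDerivAt.comp_hasDerivAt (f := fun t => (t, v)) u h.hasFDerivAt
    ((hasDerivAt_id u).prodMk (hasDerivAt_const u v))

theorem hasDerivAt_snd {V : Type*} [NormedAddCommGroup V] [NormedSpace ℝ V] {f : ℝ × ℝ → V}
    {u v : ℝ} (h : DifferentiableAt ℝ f (u, v)) :
    HasDerivAt (fun t => f (u, t)) (dv f (u, v)) v :=
  HasFDerivAt.comp_hasDerivAt (f := fun t => (u, t)) v h.hasFDerivAt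
    ((hasDerivAt_const v u).prodMk (hasDerivAt_id v))

/-- `B` and its `u`-derivative are C¹, hence locally bounded and Lipschitz; the second-order
estimate is the mean value inequality for t ↦ B(t, v) - (t - u) B_u(u, v). -/
theorem exists_isControlled {B : ℝ × ℝ → E →L[ℝ] E} {D : Set (ℝ × ℝ)} {p₀ : ℝ × ℝ}
    (hD : IsOpen D) (hB : ContDiffOn ℝ ∞ B D) (hp : p₀ ∈ D) :
    ∃ δ > 0, ∃ C, square p₀ δ ⊆ D ∧ IsControlled B p₀ δ C := by
  have hBd : ContDiffOn ℝ ∞ (fderiv ℝ B) D := hB.fderiv_of_isOpen hD (by simp)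
  have hBu : ContDiffOn ℝ ∞ (du B) D := hBd.clm_apply contDiffOn_const
  obtain ⟨K, s, hs, hK⟩ := ((hB.contDiffAt (hD.mem_nhds hp)).of_le
    (by norm_cast)).exists_lipschitzOnWith
  obtain ⟨K', s', hs', hK'⟩ := ((hBu.contDiffAt (hD.mem_nhds hp)).of_le
    (by norm_cast)).exists_lipschitzOnWith
  have hn1 : ∀ᶠ p in 𝓝 p₀, ‖B p‖ < ‖B p₀‖ + 1 :=
    (hB.continuousOn.continuousAt (hD.mem_nhds hp)).norm.eventually_lt_const (by linarith)
  have hn2 : ∀ᶠ p in 𝓝 p₀, ‖du B p‖ < ‖du B p₀‖ + 1 :=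
    (hBu.continuousOn.continuousAt (hD.mem_nhds hp)).norm.eventually_lt_const (by linarith)
  obtain ⟨δ, hδ, hsub⟩ := nhds_basis_closedBall.mem_iff.1
    (inter_mem (inter_mem hs hs') (inter_mem (hD.mem_nhds hp) (inter_mem hn1 hn2)))
  rw [closedBall_eq_square] at hsub
  refine ⟨δ, hδ, max (max K K') (max (‖B p₀‖ + 1) (‖du B p₀‖ + 1)),
    fun p hp => (hsub hp).2.1, ?_, ?_, ?_, ?_⟩
  · exact fun p hp => (hsub hp).2.2.1.le.trans (by simp)
  · exact fun p hp => (hsub hp).2.2.2.le.trans (by simp)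
  · intro u u' v h1 h2
    have := hK.dist_le_mul _ (hsub h2).1.1 _ (hsub h1).1.1
    rw [dist_eq_norm, Prod.dist_eq, dist_self, Real.dist_eq, max_eq_left (abs_nonneg _)] at this
    refine this.trans ?_
    gcongr
    simp
  · intro u u' v h1 h2
    have hseg : ∀ t ∈ uIcc u u', (t, v) ∈ square p₀ δ := by
      intro t ht
      exact ⟨(ordConnected_Icc.uIcc_subset h1.1 h2.1) ht, h1.2⟩
    have hd : ∀ t ∈ uIcc u u', HasDerivWithinAt (fun t => B (t, v) - (t - u) • du B (u, v))
        (du B (t, v) - du B (u, v)) (uIcc u u') t := by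
      intro t ht
      have hdiff : DifferentiableAt ℝ B (t, v) :=
        (hB.contDiffAt (hD.mem_nhds (hsub (hseg t ht)).2.1)).differentiableAt (by simp)
      have h3 := (hasDerivAt_fst hdiff).sub
        (((hasDerivAt_id t).sub_const u).smul_const (du B (u, v)))
      exact h3.hasDerivWithinAt.congr_deriv (by simp)
    have hbd : ∀ t ∈ uIcc u u', ‖du B (t, v) - du B (u, v)‖ ≤ K' * |u' - u| := by
      intro t ht
      have := hK'.dist_le_mul _ (hsub (hseg t ht)).1.2 _ (hsub h1).1.2
      rw [dist_eq_norm, Prod.dist_eq, dist_self, Real.dist_eq, max_eq_left (abs_nonneg _)] at this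
      exact this.trans (mul_le_mul_of_nonneg_left (abs_sub_left_of_mem_uIcc ht) K'.2)
    have := (convex_uIcc u u').norm_image_sub_le_of_norm_hasDerivWithin_le hd hbd
      left_mem_uIcc right_mem_uIcc
    simp only [sub_self, zero_smul, sub_zero, Real.norm_eq_abs] at this
    calc _ = ‖B (u', v) - (u' - u) • du B (u, v) - B (u, v)‖ := by congr 1; abel
      _ ≤ K' * |u' - u| * |u' - u| := this
      _ = K' * |u' - u| ^ 2 := by ring
      _ ≤ _ := by gcongr; simp

/-- The family of solutions in the variable `v` with initial values solving the equation in `u`. -/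
theorem exists_partial_solution [CompleteSpace E] {A B : ℝ × ℝ → E →L[ℝ] E} {p₀ : ℝ × ℝ}
    {δ C : ℝ} (hδ : 0 < δ) (hC : 1 ≤ C) (hCδ : C * δ ≤ 1 / 2)
    (hA : ContinuousOn A (square p₀ δ)) (hB : ContinuousOn B (square p₀ δ))
    (hAb : ∀ p ∈ square p₀ δ, ‖A p‖ ≤ C) (hBb : ∀ p ∈ square p₀ δ, ‖B p‖ ≤ C) (x₀ : E) :
    ∃ F : ℝ × ℝ → E, F p₀ = x₀ ∧
      (∀ u ∈ Icc (p₀.1 - δ) (p₀.1 + δ), HasDerivWithinAt (fun t => F (t, p₀.2))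
        (A (u, p₀.2) (F (u, p₀.2))) (Icc (p₀.1 - δ) (p₀.1 + δ)) u) ∧
      (∀ u ∈ Icc (p₀.1 - δ) (p₀.1 + δ), ∀ v ∈ Icc (p₀.2 - δ) (p₀.2 + δ),
        HasDerivWithinAt (fun t => F (u, t)) (B (u, v) (F (u, v)))
          (Icc (p₀.2 - δ) (p₀.2 + δ)) v) := by
  have hu₀ : p₀.1 ∈ Icc (p₀.1 - δ) (p₀.1 + δ) := ⟨by linarith, by linarith⟩
  have hv₀ : p₀.2 ∈ Icc (p₀.2 - δ) (p₀.2 + δ) := ⟨by linarith, by linarith⟩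
  -- Solve along the horizontal line through `p₀`, then vertically from each of its points. That the
  -- `u`-equation holds off this line is where integrability will enter.
  obtain ⟨f, hf₀, hf⟩ := exists_linear_ode_of_short (M := fun t => A (t, p₀.2)) hC hδ hCδ
    (hA.comp (by fun_prop) fun t ht => ⟨ht, hv₀⟩) (fun t ht => hAb _ ⟨ht, hv₀⟩) x₀
  have hex : ∀ u, ∃ g : ℝ → E, g p₀.2 = f u ∧ (u ∈ Icc (p₀.1 - δ) (p₀.1 + δ) →
      ∀ v ∈ Icc (p₀.2 - δ) (p₀.2 + δ),
        HasDerivWithinAt g (B (u, v) (g v)) (Icc (p₀.2 - δ) (p₀.2 + δ)) v) := by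
    intro u
    by_cases hu : u ∈ Icc (p₀.1 - δ) (p₀.1 + δ)
    · obtain ⟨g, hg₀, hg⟩ := exists_linear_ode_of_short (M := fun t => B (u, t)) hC hδ hCδ
        (hB.comp (by fun_prop) fun t ht => ⟨hu, ht⟩) (fun t ht => hBb _ ⟨hu, ht⟩) (f u)
      exact ⟨g, hg₀, fun _ => hg⟩
    · exact ⟨fun _ => f u, rfl, fun h => absurd h hu⟩
  choose g hg₀ hg using hex
  refine ⟨fun p => g p.1 p.2, by simp [hg₀, hf₀], fun u hu => ?_, fun u hu v hv => hg u hu v hv⟩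
  simpa [hg₀] using hf u hu

theorem const_mul_sq_isLittleO (c u : ℝ) :
    (fun t : ℝ => c * |t - u| ^ 2) =o[𝓝 u] fun t => t - u := by
  have h2 : (fun t : ℝ => c * |t - u| ^ 2) = fun t => (c * (t - u)) * (t - u) := by
    ext t; rw [sq_abs]; ring
  rw [h2]
  have h3 : Tendsto (fun t : ℝ => c * (t - u)) (𝓝 u) (𝓝 0) := by
    have : ContinuousAt (fun t : ℝ => c * (t - u)) u := by fun_prop
    simpa [ContinuousAt] using this
  have h4 := ((Asymptotics.isLittleO_one_iff ℝ).2 h3).mul_isBigO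
    (Asymptotics.isBigO_refl (fun t : ℝ => t - u) (𝓝 u))
  simpa using h4

/-- Local solvability of a completely integrable linear system. -/
theorem exists_solution_of_integrable [CompleteSpace E] {A B : ℝ × ℝ → E →L[ℝ] E}
    {D : Set (ℝ × ℝ)} (hD : IsOpen D) (hA : ContDiffOn ℝ ∞ A D) (hB : ContDiffOn ℝ ∞ B D)
    (hAB : ∀ p ∈ D, ∀ y, dv A p y + A p (B p y) = du B p y + B p (A p y)) {p₀ : ℝ × ℝ}
    (hp₀ : p₀ ∈ D) (x₀ : E) :
    ∃ δ > 0, ball p₀ δ ⊆ D ∧ ∃ F : ℝ × ℝ → E, F p₀ = x₀ ∧ ∀ p ∈ ball p₀ δ,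
      DifferentiableAt ℝ F p ∧ du F p = A p (F p) ∧ dv F p = B p (F p) := by
  obtain ⟨δ₁, hδ₁, C₁, hD₁, h₁⟩ := exists_isControlled hD hA hp₀
  obtain ⟨δ₂, hδ₂, C₂, hD₂, h₂⟩ := exists_isControlled hD hB hp₀
  set C := max 1 (max C₁ C₂) with hCdef
  set δ := min (min δ₁ δ₂) (1 / (2 * C)) with hδdef
  have hC : 1 ≤ C := le_max_left _ _
  have hC0 : 0 ≤ C := by linarith
  have hδ : 0 < δ := by positivity
  have hCδ : C * δ ≤ 1 / 2 := by
    calc C * δ ≤ C * (1 / (2 * C)) := by gcongr; exact min_le_right _ _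
      _ = 1 / 2 := by field_simp
  have hcA : IsControlled A p₀ δ C := h₁.mono (by simp [hδdef]) (by simp [hCdef])
  have hcB : IsControlled B p₀ δ C := h₂.mono (by simp [hδdef]) (by simp [hCdef])
  have hsD : square p₀ δ ⊆ D := by
    refine subset_trans ?_ hD₁
    rw [← closedBall_eq_square, ← closedBall_eq_square]
    exact closedBall_subset_closedBall (by simp [hδdef])
  obtain ⟨F, hF₀, hFu, hFv⟩ := exists_partial_solution hδ hC hCδ (hA.continuousOn.mono hsD)
    (hB.continuousOn.mono hsD) hcA.bound hcB.bound x₀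
  have hu₀ : p₀.1 ∈ Icc (p₀.1 - δ) (p₀.1 + δ) := ⟨by linarith, by linarith⟩
  have hv₀ : p₀.2 ∈ Icc (p₀.2 - δ) (p₀.2 + δ) := ⟨by linarith, by linarith⟩
  -- One factor 2 comes from the horizontal Grönwall estimate and another from the vertical one.
  set M := 4 * ‖x₀‖ with hM
  have hM0 : 0 ≤ M := by positivity
  have hbase : ∀ u ∈ Icc (p₀.1 - δ) (p₀.1 + δ), ‖F (u, p₀.2)‖ ≤ 2 * ‖x₀‖ := by
    intro u hu
    have := norm_le_of_norm_deriv_le_of_short hC hCδ le_rfl hFu (fun t ht => by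
      rw [add_zero]
      exact (A _).le_of_opNorm_le (hcA.bound (t, p₀.2) ⟨ht, hv₀⟩) _) u hu
    simpa [hF₀] using this
  have hbound : ∀ p ∈ square p₀ δ, ‖F p‖ ≤ M := by
    intro p hp
    have := norm_le_of_norm_deriv_le_of_short hC hCδ le_rfl (hFv p.1 hp.1) (fun t ht => by
      rw [add_zero]
      exact (B _).le_of_opNorm_le (hcB.bound (p.1, t) ⟨hp.1, ht⟩) _) p.2 hp.2
    have h3 := hbase p.1 hp.1
    simp only [Prod.mk.eta] at this
    linarith
  have hbase_lip : ∀ u ∈ Icc (p₀.1 - δ) (p₀.1 + δ), ∀ u' ∈ Icc (p₀.1 - δ) (p₀.1 + δ),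
      ‖F (u', p₀.2) - F (u, p₀.2)‖ ≤ C * M * |u' - u| := by
    intro u hu u' hu'
    exact (convex_Icc _ _).norm_image_sub_le_of_norm_hasDerivWithin_le hFu (fun t ht =>
      (A _).le_of_opNorm_le_of_le (hcA.bound _ ⟨ht, hv₀⟩) (hbound _ ⟨ht, hv₀⟩)) hu hu'
  have hlip_v : ∀ u ∈ Icc (p₀.1 - δ) (p₀.1 + δ), ∀ v ∈ Icc (p₀.2 - δ) (p₀.2 + δ),
      ∀ v' ∈ Icc (p₀.2 - δ) (p₀.2 + δ), ‖F (u, v') - F (u, v)‖ ≤ C * M * |v' - v| := by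
    intro u hu v hv v' hv'
    exact (convex_Icc _ _).norm_image_sub_le_of_norm_hasDerivWithin_le (hFv u hu) (fun t ht =>
      (B _).le_of_opNorm_le_of_le (hcB.bound _ ⟨hu, ht⟩) (hbound _ ⟨hu, ht⟩)) hv hv'
  have hlip_u : ∀ u ∈ Icc (p₀.1 - δ) (p₀.1 + δ), ∀ u' ∈ Icc (p₀.1 - δ) (p₀.1 + δ),
      ∀ v ∈ Icc (p₀.2 - δ) (p₀.2 + δ), ‖F (u', v) - F (u, v)‖ ≤ 4 * C * M * |u' - u| := by
    intro u hu u' hu' v hv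
    have := norm_le_of_norm_deriv_le_of_short (f := fun t => F (u', t) - F (u, t)) hC hCδ
      (ε := C * |u' - u| * M) (by positivity)
      (fun t ht => (hFv u' hu' t ht).sub (hFv u hu t ht)) (fun t ht => by
        have e : B (u', t) (F (u', t)) - B (u, t) (F (u, t)) =
            B (u', t) (F (u', t) - F (u, t)) + (B (u', t) - B (u, t)) (F (u, t)) := by
          simp
        rw [e]
        refine (norm_add_le _ _).trans (add_le_add ?_ ?_)
        · exact (B _).le_of_opNorm_le (hcB.bound _ ⟨hu', ht⟩) _
        · exact ContinuousLinearMap.le_of_opNorm_le_of_le _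
            (hcB.lipschitz _ _ _ ⟨hu, ht⟩ ⟨hu', ht⟩) (hbound _ ⟨hu, ht⟩)) v hv
    have h3 := hbase_lip u hu u' hu'
    refine this.trans ?_
    nlinarith
  -- The key estimate: as a function of v, the first-order remainder of F in the direction u
  -- satisfies R' = B R + O(|u' - u|²), so Grönwall carries differentiability in u from the base
  -- line to every v.
  have hrem : ∀ u ∈ Icc (p₀.1 - δ) (p₀.1 + δ), ∀ u' ∈ Icc (p₀.1 - δ) (p₀.1 + δ),
      ∀ v ∈ Icc (p₀.2 - δ) (p₀.2 + δ),
      ‖F (u', v) - F (u, v) - (u' - u) • A (u, v) (F (u, v))‖ ≤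
        2 * (‖F (u', p₀.2) - F (u, p₀.2) - (u' - u) • A (u, p₀.2) (F (u, p₀.2))‖ +
          (C * M + 4 * C ^ 2 * M) * |u' - u| ^ 2) := by
    intro u hu u' hu' v hv
    refine norm_le_of_norm_deriv_le_of_short
      (f := fun t => F (u', t) - F (u, t) - (u' - u) • A (u, t) (F (u, t)))
      (f' := fun t => B (u', t) (F (u', t)) - B (u, t) (F (u, t)) -
        (u' - u) • (dv A (u, t) (F (u, t)) + A (u, t) (B (u, t) (F (u, t))))) hC hCδ
      (by positivity) (fun t ht => ?_) (fun t ht => ?_) v hv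
    · refine ((hFv u' hu' t ht).sub (hFv u hu t ht)).sub (HasDerivWithinAt.const_smul _ ?_)
      have hdiff : DifferentiableAt ℝ A (u, t) :=
        (hA.contDiffAt (hD.mem_nhds (hsD ⟨hu, ht⟩))).differentiableAt (by simp)
      exact (hasDerivAt_snd hdiff).hasDerivWithinAt.clm_apply (hFv u hu t ht)
    -- Integrability trades the v-derivative of A F for the u-derivative of B F. What is left
    -- besides B R is the Taylor remainder of B and a product of two first-order increments, both
    -- quadratic in u' - u.
    · rw [hAB _ (hsD ⟨hu, ht⟩)]
      have e : B (u', t) (F (u', t)) - B (u, t) (F (u, t)) -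
          (u' - u) • (du B (u, t) (F (u, t)) + B (u, t) (A (u, t) (F (u, t)))) =
          B (u, t) (F (u', t) - F (u, t) - (u' - u) • A (u, t) (F (u, t))) +
          ((B (u', t) - B (u, t) - (u' - u) • du B (u, t)) (F (u', t)) +
            (u' - u) • du B (u, t) (F (u', t) - F (u, t))) := by
        simp only [map_sub, map_smul, sub_apply,
          smul_apply, smul_sub, smul_add]
        abel
      rw [e]
      refine (norm_add_le _ _).trans (add_le_add ?_ ((norm_add_le _ _).trans ?_))
      · exact (B _).le_of_opNorm_le (hcB.bound _ ⟨hu, ht⟩) _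
      · have h3 := ContinuousLinearMap.le_of_opNorm_le_of_le _
          (hcB.taylor _ _ _ ⟨hu, ht⟩ ⟨hu', ht⟩) (hbound (u', t) ⟨hu', ht⟩)
        have h4 := ContinuousLinearMap.le_of_opNorm_le_of_le _
          (hcB.bound_du (u, t) ⟨hu, ht⟩) (hlip_u u hu u' hu' t ht)
        rw [norm_smul, Real.norm_eq_abs]
        calc _ ≤ C * |u' - u| ^ 2 * M + |u' - u| * (C * (4 * C * M * |u' - u|)) := by gcongr
          _ = _ := by ring
  have hball : ball p₀ δ = Ioo (p₀.1 - δ) (p₀.1 + δ) ×ˢ Ioo (p₀.2 - δ) (p₀.2 + δ) := by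
    rw [← Real.ball_eq_Ioo, ← Real.ball_eq_Ioo, ball_prod_same]
  have hbs : ball p₀ δ ⊆ square p₀ δ := by
    rw [← closedBall_eq_square]; exact ball_subset_closedBall
  have hderiv_u : ∀ p ∈ ball p₀ δ, HasDerivAt (fun t => F (t, p.2)) (A p (F p)) p.1 := by
    intro p hp
    have hp' := hbs hp
    rw [hball] at hp
    have hnhds : Icc (p₀.1 - δ) (p₀.1 + δ) ∈ 𝓝 p.1 := Icc_mem_nhds hp.1.1 hp.1.2
    rw [hasDerivAt_iff_isLittleO]
    have h3 := (hasDerivAt_iff_isLittleO.1 ((hFu p.1 hp'.1).hasDerivAt hnhds)).norm_left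
    have h4 := (h3.add (const_mul_sq_isLittleO (C * M + 4 * C ^ 2 * M) p.1)).const_mul_left 2
    refine Asymptotics.IsBigO.trans_isLittleO (Asymptotics.IsBigO.of_bound 1 ?_) h4
    filter_upwards [hnhds] with t ht
    rw [one_mul]
    refine (hrem p.1 hp'.1 t ht p.2 hp'.2).trans (le_of_eq_of_le ?_ (le_abs_self _))
    rfl
  have hderiv_v : ∀ p ∈ ball p₀ δ, HasDerivAt (fun t => F (p.1, t)) (B p (F p)) p.2 := by
    intro p hp
    have hp' := hbs hp
    rw [hball] at hp
    exact (hFv p.1 hp'.1 p.2 hp'.2).hasDerivAt (Icc_mem_nhds hp.2.1 hp.2.2)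
  have hcont : ∀ p ∈ ball p₀ δ, ContinuousAt F p := by
    intro p hp
    have hp' := hbs hp
    rw [ContinuousAt, tendsto_iff_norm_sub_tendsto_zero]
    refine squeeze_zero' (g := fun q => 4 * C * M * |q.1 - p.1| + C * M * |q.2 - p.2|)
      (Eventually.of_forall fun _ => norm_nonneg _) ?_ ?_
    · filter_upwards [isOpen_ball.mem_nhds hp] with q hq
      have hq' := hbs hq
      have e : F q - F p = (F (q.1, q.2) - F (p.1, q.2)) + (F (p.1, q.2) - F (p.1, p.2)) := by
        simp
      rw [e]
      exact (norm_add_le _ _).trans (add_le_add (hlip_u _ hp'.1 _ hq'.1 _ hq'.2)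
        (hlip_v _ hp'.1 _ hp'.2 _ hq'.2))
    · have : ContinuousAt (fun q : ℝ × ℝ => 4 * C * M * |q.1 - p.1| + C * M * |q.2 - p.2|) p := by
        fun_prop
      simpa [ContinuousAt] using this
  have hcontA : ∀ p ∈ ball p₀ δ, ContinuousAt (fun p => A p (F p)) p := fun p hp =>
    (hA.continuousOn.continuousAt (hD.mem_nhds (hsD (hbs hp)))).clm_apply (hcont p hp)
  have hcontB : ∀ p ∈ ball p₀ δ, ContinuousAt (fun p => B p (F p)) p := fun p hp =>
    (hB.continuousOn.continuousAt (hD.mem_nhds (hsD (hbs hp)))).clm_apply (hcont p hp)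
  refine ⟨δ, hδ, hbs.trans hsD, F, hF₀, fun p hp => ?_⟩
  have hev : ∀ᶠ q in 𝓝 p, q ∈ ball p₀ δ := isOpen_ball.mem_nhds hp
  -- Both partial derivatives exist near p and are continuous at p, whence F is differentiable
  -- there.
  have hstrict := hasStrictFDerivAt_uncurry_coprod (𝕜 := ℝ) (u := p) (f := fun s t => F (s, t))
    (f₁ := fun s t => ContinuousLinearMap.toSpanSingleton ℝ (A (s, t) (F (s, t))))
    (f₂ := fun s t => ContinuousLinearMap.toSpanSingleton ℝ (B (s, t) (F (s, t))))
    (hev.mono fun q hq => (hderiv_u q hq).hasFDerivAt)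
    (hev.mono fun q hq => (hderiv_v q hq).hasFDerivAt)
    ((ContinuousLinearMap.toSpanSingletonCLE (𝕜 := ℝ) (E := E)).continuous.continuousAt.comp
      (hcontA p hp))
    ((ContinuousLinearMap.toSpanSingletonCLE (𝕜 := ℝ) (E := E)).continuous.continuousAt.comp
      (hcontB p hp))
  have hfd := hstrict.hasFDerivAt
  have hFe : (↿fun s t => F (s, t)) = F := rfl
  rw [hFe] at hfd
  refine ⟨hfd.differentiableAt, ?_, ?_⟩
  · rw [du, hfd.fderiv]
    simp [Function.HasUncurry.uncurry]
  · rw [dv, hfd.fderiv]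
    simp [Function.HasUncurry.uncurry]

end Frobenius

/-! ### Calculus with the two partial derivatives. -/

section Calculus

open Set Metric Filter Topology

variable {V : Type*} [NormedAddCommGroup V] [NormedSpace ℝ V]

/-- `f` is differentiable at `p`, with partial derivatives `fu` and `fv`. -/
def HasPartials (f : ℝ × ℝ → V) (fu fv : V) (p : ℝ × ℝ) : Prop :=
  HasFDerivAt f ((ContinuousLinearMap.fst ℝ ℝ ℝ).smulRight fu +
    (ContinuousLinearMap.snd ℝ ℝ ℝ).smulRight fv) p

theorem fderiv_eq_du_dv (f : ℝ × ℝ → V) (p : ℝ × ℝ) :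
    fderiv ℝ f p = (ContinuousLinearMap.fst ℝ ℝ ℝ).smulRight (du f p) +
      (ContinuousLinearMap.snd ℝ ℝ ℝ).smulRight (dv f p) := by
  refine ContinuousLinearMap.ext fun w => ?_
  have : w = w.1 • ((1, 0) : ℝ × ℝ) + w.2 • ((0, 1) : ℝ × ℝ) := by ext <;> simp
  conv_lhs => rw [this, map_add, map_smul, map_smul]
  rfl

namespace HasPartials

variable {f g : ℝ × ℝ → V} {fu fv gu gv : V} {p : ℝ × ℝ} {h k : ℝ × ℝ → ℝ} {hu hv ku kv : ℝ}

theorem of_differentiableAt (hf : DifferentiableAt ℝ f p) :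
    HasPartials f (TimelikeZMC.du f p) (TimelikeZMC.dv f p) p := by
  rw [HasPartials, ← fderiv_eq_du_dv]
  exact hf.hasFDerivAt

theorem of_eq (hf : DifferentiableAt ℝ f p) (h1 : TimelikeZMC.du f p = fu)
    (h2 : TimelikeZMC.dv f p = fv) : HasPartials f fu fv p :=
  h1 ▸ h2 ▸ of_differentiableAt hf

theorem differentiableAt (hf : HasPartials f fu fv p) : DifferentiableAt ℝ f p :=
  HasFDerivAt.differentiableAt hf

theorem du (hf : HasPartials f fu fv p) : TimelikeZMC.du f p = fu := by
  rw [TimelikeZMC.du, HasFDerivAt.fderiv hf]; simp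

theorem dv (hf : HasPartials f fu fv p) : TimelikeZMC.dv f p = fv := by
  rw [TimelikeZMC.dv, HasFDerivAt.fderiv hf]; simp

theorem congr (hf : HasPartials f fu fv p) (h1 : fu = gu) (h2 : fv = gv) :
    HasPartials f gu gv p := h1 ▸ h2 ▸ hf

theorem congr_on {D : Set (ℝ × ℝ)} (hf : HasPartials f fu fv p) (hD : IsOpen D) (hp : p ∈ D)
    (h : EqOn g f D) : HasPartials g fu fv p :=
  HasFDerivAt.congr_of_eventuallyEq hf (h.eventuallyEq_of_mem (hD.mem_nhds hp))

theorem const (c : V) (p : ℝ × ℝ) : HasPartials (fun _ => c) 0 0 p := by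
  have := hasFDerivAt_const (𝕜 := ℝ) c p
  unfold HasPartials
  convert this using 1
  ext <;> simp

theorem add (hf : HasPartials f fu fv p) (hg : HasPartials g gu gv p) :
    HasPartials (fun q => f q + g q) (fu + gu) (fv + gv) p := by
  refine (HasFDerivAt.add hf hg).congr_fderiv ?_
  ext <;> simp

theorem sub (hf : HasPartials f fu fv p) (hg : HasPartials g gu gv p) :
    HasPartials (fun q => f q - g q) (fu - gu) (fv - gv) p := by
  refine (HasFDerivAt.sub hf hg).congr_fderiv ?_
  ext <;> simp

theorem neg (hf : HasPartials f fu fv p) : HasPartials (fun q => -f q) (-fu) (-fv) p := by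
  refine (HasFDerivAt.neg hf).congr_fderiv ?_
  ext <;> simp

theorem smul (hh : HasPartials h hu hv p) (hf : HasPartials f fu fv p) :
    HasPartials (fun q => h q • f q) (hu • f p + h p • fu) (hv • f p + h p • fv) p := by
  refine (HasFDerivAt.smul hh hf).congr_fderiv ?_
  ext <;> simp [add_comm]

theorem mul (hh : HasPartials h hu hv p) (hk : HasPartials k ku kv p) :
    HasPartials (fun q => h q * k q) (hu * k p + h p * ku) (hv * k p + h p * kv) p :=
  hh.smul hk

theorem comp_hasDerivAt {φ : ℝ → ℝ} {φ' : ℝ} (hφ : HasDerivAt φ φ' (h p))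
    (hh : HasPartials h hu hv p) :
    HasPartials (fun q => φ (h q)) (φ' * hu) (φ' * hv) p := by
  refine (hφ.comp_hasFDerivAt p hh).congr_fderiv ?_
  ext <;> simp

theorem inv (hh : HasPartials h hu hv p) (h0 : h p ≠ 0) :
    HasPartials (fun q => (h q)⁻¹) (-hu / h p ^ 2) (-hv / h p ^ 2) p :=
  (hh.comp_hasDerivAt (hasDerivAt_inv h0)).congr (by ring) (by ring)

theorem div (hh : HasPartials h hu hv p) (hk : HasPartials k ku kv p) (h0 : k p ≠ 0) :
    HasPartials (fun q => h q / k q) ((hu * k p - h p * ku) / k p ^ 2)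
      ((hv * k p - h p * kv) / k p ^ 2) p := by
  simp only [div_eq_mul_inv]
  refine (hh.mul (hk.inv h0)).congr ?_ ?_ <;> field_simp <;> ring

theorem sum {ι : Type*} {s : Finset ι} {F : ι → ℝ × ℝ → V} {Fu Fv : ι → V}
    (hF : ∀ i ∈ s, HasPartials (F i) (Fu i) (Fv i) p) :
    HasPartials (fun q => ∑ i ∈ s, F i q) (∑ i ∈ s, Fu i) (∑ i ∈ s, Fv i) p := by
  refine (HasFDerivAt.fun_sum hF).congr_fderiv ?_
  ext <;> simp

theorem clm_comp {W : Type*} [NormedAddCommGroup W] [NormedSpace ℝ W] (L : V →L[ℝ] W)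
    (hf : HasPartials f fu fv p) : HasPartials (fun q => L (f q)) (L fu) (L fv) p := by
  refine (L.hasFDerivAt.comp p hf).congr_fderiv ?_
  ext <;> simp

theorem apply {n : ℕ} {X : ℝ × ℝ → Fin n → V} {Xu Xv : Fin n → V} (hX : HasPartials X Xu Xv p)
    (i : Fin n) : HasPartials (fun q => X q i) (Xu i) (Xv i) p :=
  hX.clm_comp (ContinuousLinearMap.proj i)

theorem mink {X Y : ℝ × ℝ → R41} {Xu Xv Yu Yv : R41} (hX : HasPartials X Xu Xv p)
    (hY : HasPartials Y Yu Yv p) :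
    HasPartials (fun q => TimelikeZMC.mink (X q) (Y q))
      (TimelikeZMC.mink Xu (Y p) + TimelikeZMC.mink (X p) Yu)
      (TimelikeZMC.mink Xv (Y p) + TimelikeZMC.mink (X p) Yv) p := by
  have := (((hX.apply 0).mul (hY.apply 0)).add ((hX.apply 1).mul (hY.apply 1))).add
    ((hX.apply 2).mul (hY.apply 2)) |>.sub ((hX.apply 3).mul (hY.apply 3))
  refine HasPartials.congr this ?_ ?_ <;> simp only [TimelikeZMC.mink] <;> ring

end HasPartials

variable {D : Set (ℝ × ℝ)} {f g : ℝ × ℝ → V} {p : ℝ × ℝ}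

theorem differentiableAt_of_contDiffOn (hf : ContDiffOn ℝ ∞ f D) (hD : IsOpen D) (hp : p ∈ D) :
    DifferentiableAt ℝ f p :=
  (hf.contDiffAt (hD.mem_nhds hp)).differentiableAt (by simp)

theorem hasPartials_of_contDiffOn (hf : ContDiffOn ℝ ∞ f D) (hD : IsOpen D) (hp : p ∈ D) :
    HasPartials f (du f p) (dv f p) p :=
  .of_differentiableAt (differentiableAt_of_contDiffOn hf hD hp)

theorem contDiffOn_du (hf : ContDiffOn ℝ ∞ f D) (hD : IsOpen D) : ContDiffOn ℝ ∞ (du f) D :=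
  (hf.fderiv_of_isOpen hD (by simp)).clm_apply contDiffOn_const

theorem contDiffOn_dv (hf : ContDiffOn ℝ ∞ f D) (hD : IsOpen D) : ContDiffOn ℝ ∞ (dv f) D :=
  (hf.fderiv_of_isOpen hD (by simp)).clm_apply contDiffOn_const

theorem du_congr_on (hD : IsOpen D) (h : EqOn f g D) : EqOn (du f) (du g) D := fun p hp => by
  rw [du, du, (h.eventuallyEq_of_mem (hD.mem_nhds hp)).fderiv_eq]

theorem dv_congr_on (hD : IsOpen D) (h : EqOn f g D) : EqOn (dv f) (dv g) D := fun p hp => by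
  rw [dv, dv, (h.eventuallyEq_of_mem (hD.mem_nhds hp)).fderiv_eq]

theorem dv_du_eq_du_dv (hf : ContDiffOn ℝ ∞ f D) (hD : IsOpen D) (hp : p ∈ D) :
    dv (du f) p = du (dv f) p := by
  have hs : IsSymmSndFDerivAt ℝ f p :=
    (hf.contDiffAt (hD.mem_nhds hp)).isSymmSndFDerivAt
      (by rw [minSmoothness_of_isRCLikeNormedField]; exact WithTop.coe_le_coe.2 le_top)
  have hd : DifferentiableAt ℝ (fderiv ℝ f) p :=
    differentiableAt_of_contDiffOn (hf.fderiv_of_isOpen hD (by simp)) hD hp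
  have e : ∀ w w' : ℝ × ℝ, fderiv ℝ (fun q => fderiv ℝ f q w) p w' =
      fderiv ℝ (fderiv ℝ f) p w' w := by
    intro w w'
    rw [fderiv_clm_apply hd (differentiableAt_const w)]
    simp
  unfold du dv
  rw [e, e]
  exact hs _ _

theorem eq_of_partials_eq_zero (hD : IsOpen D) (hc : IsConnected D)
    (hf : ∀ p ∈ D, HasPartials f 0 0 p) {q : ℝ × ℝ} (hp : p ∈ D) (hq : q ∈ D) : f p = f q := by
  refine hD.is_const_of_fderiv_eq_zero (𝕜 := ℝ) hc.isPreconnected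
    (fun x hx => (hf x hx).differentiableAt.differentiableWithinAt) (fun x hx => ?_) hp hq
  rw [fderiv_eq_du_dv, (hf x hx).du, (hf x hx).dv]
  ext <;> simp

end Calculus

/-! ### Linear systems in matrix form: smoothness, solvability, and necessity of integrability. -/

section LinearSystem

open Set Metric Filter Topology

variable {V : Type*} [NormedAddCommGroup V] [NormedSpace ℝ V] {n : ℕ} {D : Set (ℝ × ℝ)}

/-- The action of a square matrix on families of vectors. -/
def matrixAction (V : Type*) [NormedAddCommGroup V] [NormedSpace ℝ V] {n : ℕ}
    (c : Fin n → Fin n → ℝ) : (Fin n → V) →L[ℝ] (Fin n → V) :=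
  ∑ i, ∑ j, c i j • (ContinuousLinearMap.single ℝ (fun _ => V) i).comp
    (ContinuousLinearMap.proj j)

theorem matrixAction_apply (c : Fin n → Fin n → ℝ) (y : Fin n → V) (i : Fin n) :
    matrixAction V c y i = ∑ j, c i j • y j := by
  simp only [matrixAction, FunLike.coe_sum, Finset.sum_apply, smul_apply,
    ContinuousLinearMap.comp_apply, ContinuousLinearMap.proj_apply,
    ContinuousLinearMap.single_apply, Pi.smul_apply]
  rw [Finset.sum_comm]
  refine Finset.sum_congr rfl fun j _ => ?_
  simp [Pi.single_apply]

theorem hasPartials_matrixAction {A : Fin n → Fin n → ℝ × ℝ → ℝ} {p : ℝ × ℝ}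
    {Au Av : Fin n → Fin n → ℝ} (hA : ∀ i j, HasPartials (A i j) (Au i j) (Av i j) p) :
    HasPartials (fun q => matrixAction V fun i j => A i j q) (matrixAction V Au)
      (matrixAction V Av) p := by
  refine HasPartials.sum fun i _ => HasPartials.sum fun j _ => ?_
  exact ((hA i j).smul (.const _ p)).congr (by simp) (by simp)

theorem contDiffOn_matrixAction {A : Fin n → Fin n → ℝ × ℝ → ℝ}
    (hA : ∀ i j, ContDiffOn ℝ ∞ (A i j) D) :
    ContDiffOn ℝ ∞ (fun q => matrixAction V fun i j => A i j q) D :=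
  ContDiffOn.sum fun i _ => ContDiffOn.sum fun j _ => (hA i j).smul contDiffOn_const

/-- Bootstrap: the system expresses the derivative of F through F and smooth coefficients, so each
order of regularity gives the next. -/
theorem contDiffOn_of_linear_system {A B : ℝ × ℝ → V →L[ℝ] V} {F : ℝ × ℝ → V} (hD : IsOpen D)
    (hA : ContDiffOn ℝ ∞ A D) (hB : ContDiffOn ℝ ∞ B D)
    (hF : ∀ p ∈ D, DifferentiableAt ℝ F p ∧ du F p = A p (F p) ∧ dv F p = B p (F p)) :
    ContDiffOn ℝ ∞ F D := by
  rw [contDiffOn_infty]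
  intro m
  induction m with
  | zero =>
    exact contDiffOn_zero.2 fun p hp => (hF p hp).1.continuousAt.continuousWithinAt
  | succ m ih =>
    push_cast
    rw [contDiffOn_succ_iff_fderiv_of_isOpen hD]
    refine ⟨fun p hp => (hF p hp).1.differentiableWithinAt, by simp, ?_⟩
    have hA' := (hA.of_le (m := m) (by exact_mod_cast le_top)).clm_apply ih
    have hB' := (hB.of_le (m := m) (by exact_mod_cast le_top)).clm_apply ih
    have : ContDiffOn ℝ m (fun p => (ContinuousLinearMap.fst ℝ ℝ ℝ).smulRight (A p (F p)) +
        (ContinuousLinearMap.snd ℝ ℝ ℝ).smulRight (B p (F p))) D :=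
      (contDiffOn_const.smulRight hA').add (contDiffOn_const.smulRight hB')
    refine this.congr fun p hp => ?_
    rw [fderiv_eq_du_dv, (hF p hp).2.1, (hF p hp).2.2]

/-- Local solvability of a completely integrable linear system in matrix form. -/
theorem exists_solution_of_matrix_integrable [CompleteSpace V]
    {A B : Fin n → Fin n → ℝ × ℝ → ℝ} (hD : IsOpen D)
    (hA : ∀ i j, ContDiffOn ℝ ∞ (A i j) D) (hB : ∀ i j, ContDiffOn ℝ ∞ (B i j) D)
    (hAB : ∀ p ∈ D, ∀ i k, dv (A i k) p + ∑ j, A i j p * B j k p =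
      du (B i k) p + ∑ j, B i j p * A j k p)
    {p₀ : ℝ × ℝ} (hp₀ : p₀ ∈ D) (x₀ : Fin n → V) :
    ∃ δ > 0, ball p₀ δ ⊆ D ∧ ∃ X : Fin n → ℝ × ℝ → V, (∀ i, X i p₀ = x₀ i) ∧
      (∀ i, ContDiffOn ℝ ∞ (X i) (ball p₀ δ)) ∧ ∀ p ∈ ball p₀ δ, ∀ i,
        HasPartials (X i) (∑ j, A i j p • X j p) (∑ j, B i j p • X j p) p := by
  have hA' := contDiffOn_matrixAction (V := V) hA
  have hB' := contDiffOn_matrixAction (V := V) hB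
  obtain ⟨δ, hδ, hsub, F, hF₀, hF⟩ := exists_solution_of_integrable hD hA' hB' (fun p hp y => by
    rw [(hasPartials_matrixAction (V := V) fun i j => hasPartials_of_contDiffOn (hA i j) hD hp).dv,
      (hasPartials_matrixAction (V := V) fun i j => hasPartials_of_contDiffOn (hB i j) hD hp).du]
    ext1 i
    have h := hAB p hp i
    simp only [Pi.add_apply, matrixAction_apply, Finset.smul_sum, smul_smul]
    rw [Finset.sum_comm, ← Finset.sum_add_distrib]
    rw [Finset.sum_comm, ← Finset.sum_add_distrib]
    refine Finset.sum_congr rfl fun k _ => ?_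
    rw [← Finset.sum_smul, ← Finset.sum_smul, ← add_smul, ← add_smul, h k]) hp₀ x₀
  have hFs := contDiffOn_of_linear_system isOpen_ball (hA'.mono hsub) (hB'.mono hsub) hF
  refine ⟨δ, hδ, hsub, fun i q => F q i, fun i => by simp [hF₀], fun i => ?_, fun p hp i => ?_⟩
  · exact contDiffOn_pi.1 hFs i
  · refine ((HasPartials.of_differentiableAt (hF p hp).1).apply i).congr ?_ ?_
    · rw [(hF p hp).2.1, matrixAction_apply]
    · rw [(hF p hp).2.2, matrixAction_apply]

/-- The integrability conditions hold for a linear system which has a frame of solutions. -/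
theorem matrix_integrable_of_solution {A B : Fin n → Fin n → ℝ × ℝ → ℝ} {X : Fin n → ℝ × ℝ → V}
    (hD : IsOpen D) (hA : ∀ i j, ContDiffOn ℝ ∞ (A i j) D)
    (hB : ∀ i j, ContDiffOn ℝ ∞ (B i j) D) (hX : ∀ i, ContDiffOn ℝ ∞ (X i) D)
    (hXD : ∀ p ∈ D, ∀ i, HasPartials (X i) (∑ j, A i j p • X j p) (∑ j, B i j p • X j p) p)
    {p : ℝ × ℝ} (hp : p ∈ D) (hli : LinearIndependent ℝ fun i => X i p) (i k : Fin n) :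
    dv (A i k) p + ∑ j, A i j p * B j k p = du (B i k) p + ∑ j, B i j p * A j k p := by
  -- The two mixed derivatives of `X i` are both expanded in the frame at p; linear independence
  -- then allows comparison of coefficients.
  have hu : dv (du (X i)) p = ∑ j, (dv (A i j) p • X j p + A i j p • ∑ k, B j k p • X k p) := by
    refine ((HasPartials.sum fun j _ =>
      (hasPartials_of_contDiffOn (hA i j) hD hp).smul (hXD p hp j)).congr_on hD hp
        fun q hq => (hXD q hq i).du).dv
  have hv : du (dv (X i)) p = ∑ j, (du (B i j) p • X j p + B i j p • ∑ k, A j k p • X k p) := by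
    refine ((HasPartials.sum fun j _ =>
      (hasPartials_of_contDiffOn (hB i j) hD hp).smul (hXD p hp j)).congr_on hD hp
        fun q hq => (hXD q hq i).dv).du
  have e := dv_du_eq_du_dv (hX i) hD hp
  rw [hu, hv, ← sub_eq_zero] at e
  rw [← sub_eq_zero]
  refine Fintype.linearIndependent_iff.1 hli (fun k => dv (A i k) p + ∑ j, A i j p * B j k p -
    (du (B i k) p + ∑ j, B i j p * A j k p)) ?_ k
  rw [← e]
  simp only [Finset.sum_add_distrib, Finset.smul_sum, smul_smul, sub_smul, add_smul,
    Finset.sum_sub_distrib, Finset.sum_smul]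
  congr 1 <;> congr 1 <;> rw [Finset.sum_comm]

end LinearSystem

/-! ### Bilinearity of the Minkowski metric. -/

section Minkowski

theorem mink_comm (a b : R41) : mink a b = mink b a := by simp only [mink]; ring

theorem mink_add_left (a b c : R41) : mink (a + b) c = mink a c + mink b c := by
  simp only [mink, Pi.add_apply]; ring

theorem mink_add_right (a b c : R41) : mink a (b + c) = mink a b + mink a c := by
  simp only [mink, Pi.add_apply]; ring

theorem mink_smul_left (r : ℝ) (a b : R41) : mink (r • a) b = r * mink a b := by
  simp only [mink, Pi.smul_apply, smul_eq_mul]; ring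

theorem mink_smul_right (r : ℝ) (a b : R41) : mink a (r • b) = r * mink a b := by
  simp only [mink, Pi.smul_apply, smul_eq_mul]; ring

theorem mink_zero_left (a : R41) : mink 0 a = 0 := by simp [mink]

theorem mink_neg_left (a b : R41) : mink (-a) b = -mink a b := by
  simp only [mink, Pi.neg_apply]; ring

theorem mink_neg_right (a b : R41) : mink a (-b) = -mink a b := by
  simp only [mink, Pi.neg_apply]; ring

theorem mink_sum_left {ι : Type*} (s : Finset ι) (f : ι → R41) (a : R41) :
    mink (∑ i ∈ s, f i) a = ∑ i ∈ s, mink (f i) a := by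
  classical
  induction s using Finset.induction_on with
  | empty => simp [mink_zero_left]
  | insert i s hi ih => rw [Finset.sum_insert hi, Finset.sum_insert hi, mink_add_left, ih]

theorem mink_sum_right {ι : Type*} (s : Finset ι) (f : ι → R41) (a : R41) :
    mink a (∑ i ∈ s, f i) = ∑ i ∈ s, mink a (f i) := by
  rw [mink_comm, mink_sum_left]
  exact Finset.sum_congr rfl fun i _ => mink_comm _ _

theorem contDiffOn_mink {D : Set (ℝ × ℝ)} {X Y : ℝ × ℝ → R41} (hX : ContDiffOn ℝ ∞ X D)
    (hY : ContDiffOn ℝ ∞ Y D) : ContDiffOn ℝ ∞ (fun q => mink (X q) (Y q)) D := by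
  have hX' := contDiffOn_pi.1 hX
  have hY' := contDiffOn_pi.1 hY
  exact ((((hX' 0).mul (hY' 0)).add ((hX' 1).mul (hY' 1))).add ((hX' 2).mul (hY' 2))).sub
    ((hX' 3).mul (hY' 3))

end Minkowski

/-! ### Bases with Gram matrix diag(-l, l, 1, 1) and the maps between them. -/

section AdaptedBasis

/-- The squares of the vectors of an adapted basis. -/
def eps (l : ℝ) : Fin 4 → ℝ := ![-l, l, 1, 1]

theorem eps_ne_zero {l : ℝ} (hl : l ≠ 0) (i : Fin 4) : eps l i ≠ 0 := by
  fin_cases i <;> simp [eps, hl]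

/-- The Gram matrix of `X` is `diag(-l, l, 1, 1)`. -/
def IsAdapted (l : ℝ) (X : Fin 4 → R41) : Prop :=
  ∀ i j, mink (X i) (X j) = if i = j then eps l i else 0

variable {l : ℝ} {X X' : Fin 4 → R41}

theorem IsAdapted.mink_sum (hX : IsAdapted l X) (c : Fin 4 → ℝ) (j : Fin 4) :
    mink (∑ i, c i • X i) (X j) = c j * eps l j := by
  simp only [mink_sum_left, mink_smul_left, hX _ j]
  rw [Finset.sum_eq_single j] <;> simp +contextual

theorem IsAdapted.linearIndependent (hX : IsAdapted l X) (hl : l ≠ 0) :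
    LinearIndependent ℝ X := by
  refine Fintype.linearIndependent_iff.2 fun c hc j => ?_
  have := hX.mink_sum c j
  rw [hc, mink_zero_left] at this
  exact (mul_eq_zero.1 this.symm).resolve_right (eps_ne_zero hl j)

theorem IsAdapted.expansion (hX : IsAdapted l X) (hl : l ≠ 0) (w : R41) :
    w = ∑ i, (mink w (X i) / eps l i) • X i := by
  have hs := (hX.linearIndependent hl).span_eq_top_of_card_eq_finrank (by simp)
  have hw : w ∈ Submodule.span ℝ (Set.range X) := by rw [hs]; trivial
  obtain ⟨c, hc⟩ := (Submodule.mem_span_range_iff_exists_fun ℝ).1 hw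
  have h : ∀ i, mink w (X i) / eps l i = c i := fun i => by
    rw [← hc, hX.mink_sum c i, mul_div_cancel_right₀ _ (eps_ne_zero hl i)]
  simp only [h, hc]

/-- If the expansion formula reproduces every vector, then the four vectors span and so form a
basis; applied to `X j` itself, it reads off the Gram matrix by uniqueness of coefficients. This
form lets adaptedness propagate along a solution: the left-hand side is an operator that turns out
to be locally constant. -/
theorem IsAdapted.of_expansion (hl : l ≠ 0)
    (h : ∀ w, ∑ i, (mink w (X i) / eps l i) • X i = w) : IsAdapted l X := by
  have hs : (⊤ : Submodule ℝ R41) ≤ Submodule.span ℝ (Set.range X) := fun w _ =>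
    (Submodule.mem_span_range_iff_exists_fun ℝ).2 ⟨_, h w⟩
  have hli : LinearIndependent ℝ X :=
    linearIndependent_of_top_le_span_of_card_eq_finrank hs (by simp)
  intro j i
  have h0 : ∑ k, (mink (X j) (X k) / eps l k - if j = k then 1 else 0) • X k = 0 := by
    simp [sub_smul, Finset.sum_sub_distrib, h (X j)]
  have h1 := Fintype.linearIndependent_iff.1 hli _ h0 i
  have h2 := eps_ne_zero hl i
  rw [sub_eq_zero, div_eq_iff h2] at h1
  rw [h1]
  split_ifs with hij
  · rw [hij, one_mul]
  · rw [zero_mul]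

/-- Take determinants in X η Xᵀ = diag(-l, l, 1, 1) with η = diag(1, 1, 1, -1). The determinant is
thus fixed up to sign and cannot vanish for l ≠ 0. -/
theorem IsAdapted.det_sq (hX : IsAdapted l X) : (Matrix.of X).det ^ 2 = l ^ 2 := by
  have h : Matrix.of X * Matrix.diagonal ![1, 1, 1, -1] * (Matrix.of X).transpose =
      Matrix.diagonal (eps l) := by
    ext i j
    have := hX i j
    rw [Matrix.mul_apply, Matrix.diagonal_apply, ← this]
    simp [Fin.sum_univ_four, mink]
    ring
  have h2 := congrArg Matrix.det h
  simp only [Matrix.det_mul, Matrix.det_transpose, Matrix.det_diagonal, Fin.prod_univ_four, eps,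
    Matrix.cons_val] at h2
  linear_combination -h2

/-- The linear map taking the adapted basis `X` to `X'`. -/
noncomputable def transition (l : ℝ) (X X' : Fin 4 → R41) : R41 →ₗ[ℝ] R41 where
  toFun w := ∑ i, (mink w (X i) / eps l i) • X' i
  map_add' a b := by simp [mink_add_left, add_div, add_smul, Finset.sum_add_distrib]
  map_smul' r a := by simp [mink_smul_left, mul_div_assoc, mul_smul, Finset.smul_sum]

theorem transition_apply (w : R41) :
    transition l X X' w = ∑ i, (mink w (X i) / eps l i) • X' i := rfl

theorem transition_basis (hX : IsAdapted l X) (hl : l ≠ 0) (j : Fin 4) :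
    transition l X X' (X j) = X' j := by
  rw [transition_apply, Finset.sum_eq_single j]
  · rw [hX j j, if_pos rfl, div_self (eps_ne_zero hl j), one_smul]
  · intro i _ hij
    rw [hX j i, if_neg hij.symm, zero_div, zero_smul]
  · simp

theorem mink_transition (hX : IsAdapted l X) (hX' : IsAdapted l X') (hl : l ≠ 0) (a b : R41) :
    mink (transition l X X' a) (transition l X X' b) = mink a b := by
  have key : ∀ Y : Fin 4 → R41, IsAdapted l Y → ∀ c e : Fin 4 → ℝ,
      mink (∑ i, c i • Y i) (∑ j, e j • Y j) = ∑ j, e j * (c j * eps l j) := by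
    intro Y hY c e
    rw [mink_sum_right]
    exact Finset.sum_congr rfl fun j _ => by rw [mink_smul_right, hY.mink_sum]
  rw [transition_apply, transition_apply, key X' hX']
  conv_rhs => rw [hX.expansion hl a, hX.expansion hl b, key X hX]

/-- Two adapted bases have determinants of equal absolute value, and positivity makes these equal.
The transition map multiplies the one into the other, so its own determinant is 1. -/
theorem det_transition (hX : IsAdapted l X) (hX' : IsAdapted l X') (hl : l ≠ 0)
    (h : 0 < (Matrix.of X).det) (h' : 0 < (Matrix.of X').det) :
    LinearMap.det (transition l X X') = 1 := by
  have h1 : (Matrix.of X').det = (Matrix.of X).det := by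
    have := hX.det_sq.trans hX'.det_sq.symm
    exact ((sq_eq_sq₀ h.le h'.le).1 this).symm
  have h2 : Matrix.of X' =
      Matrix.of X * (LinearMap.toMatrix' (transition l X X')).transpose := by
    ext j k
    have h3 : (LinearMap.toMatrix' (transition l X X')).mulVec (X j) = X' j := by
      rw [LinearMap.toMatrix'_mulVec, transition_basis hX hl]
    rw [Matrix.mul_apply]
    change X' j k = _
    rw [← h3, Matrix.mulVec, dotProduct]
    exact Finset.sum_congr rfl fun i _ => by simp [mul_comm]
  have h3 := congrArg Matrix.det h2
  rw [Matrix.det_mul, Matrix.det_transpose, LinearMap.det_toMatrix', h1] at h3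
  exact (mul_eq_left₀ h.ne').1 h3.symm

end AdaptedBasis

/-! ### The derivation formulas of a canonical frame. -/

section Frames

/-- The coefficients of the derivation formulas of a canonical frame: `G = -E = lam`, the geometric
functions `nu`, `mu`, the coefficients `a`, `b` of the tangential and `β₁`, `β₂` of the normal
connection. -/
structure FrameData where
  lam : ℝ × ℝ → ℝ
  nu : ℝ × ℝ → ℝ
  mu : ℝ × ℝ → ℝ
  a : ℝ × ℝ → ℝ
  b : ℝ × ℝ → ℝ
  β₁ : ℝ × ℝ → ℝ
  β₂ : ℝ × ℝ → ℝ

namespace FrameData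

/-- The coefficients of the derivatives in `u` of the frame `z_u, z_v, n₁, n₂`. -/
def matU (d : FrameData) : Fin 4 → Fin 4 → ℝ × ℝ → ℝ :=
  ![![d.a, d.b, fun q => d.lam q * d.nu q, fun _ => 0],
    ![d.b, d.a, fun _ => 0, fun q => d.lam q * d.mu q],
    ![d.nu, fun _ => 0, fun _ => 0, d.β₁],
    ![fun _ => 0, fun q => -d.mu q, fun q => -d.β₁ q, fun _ => 0]]

/-- The coefficients of the derivatives in `v` of the frame `z_u, z_v, n₁, n₂`. -/
def matV (d : FrameData) : Fin 4 → Fin 4 → ℝ × ℝ → ℝ :=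
  ![![d.b, d.a, fun _ => 0, fun q => d.lam q * d.mu q],
    ![d.a, d.b, fun q => d.lam q * d.nu q, fun _ => 0],
    ![fun _ => 0, fun q => -d.nu q, fun _ => 0, d.β₂],
    ![d.mu, fun _ => 0, fun q => -d.β₂ q, fun _ => 0]]

/-- The properties of the coefficients of a canonical frame which do not involve integrability. -/
structure IsRegular (d : FrameData) (D : Set (ℝ × ℝ)) : Prop where
  lam_smooth : ContDiffOn ℝ ∞ d.lam D
  nu_smooth : ContDiffOn ℝ ∞ d.nu D
  mu_smooth : ContDiffOn ℝ ∞ d.mu D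
  a_smooth : ContDiffOn ℝ ∞ d.a D
  b_smooth : ContDiffOn ℝ ∞ d.b D
  β₁_smooth : ContDiffOn ℝ ∞ d.β₁ D
  β₂_smooth : ContDiffOn ℝ ∞ d.β₂ D
  lam_pos : ∀ p ∈ D, 0 < d.lam p
  canon : ∀ p ∈ D, d.lam p ^ 2 * (d.nu p ^ 2 + d.mu p ^ 2) = 1
  nu_ne : ∀ p ∈ D, d.nu p ≠ 0
  mu_ne : ∀ p ∈ D, d.mu p ≠ 0
  lam_partials : ∀ p ∈ D, HasPartials d.lam (2 * d.lam p * d.a p) (2 * d.lam p * d.b p) p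

variable {d : FrameData} {D : Set (ℝ × ℝ)}

theorem IsRegular.contDiffOn_matU (h : d.IsRegular D) (i j : Fin 4) :
    ContDiffOn ℝ ∞ (d.matU i j) D := by
  have h1 := h.lam_smooth.mul h.nu_smooth
  have h2 := h.lam_smooth.mul h.mu_smooth
  have h3 : ContDiffOn ℝ ∞ (fun _ : ℝ × ℝ => (0 : ℝ)) D := contDiffOn_const
  fin_cases i <;> fin_cases j
  exacts [h.a_smooth, h.b_smooth, h1, h3, h.b_smooth, h.a_smooth, h3, h2, h.nu_smooth, h3, h3,
    h.β₁_smooth, h3, h.mu_smooth.neg, h.β₁_smooth.neg, h3]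

theorem IsRegular.contDiffOn_matV (h : d.IsRegular D) (i j : Fin 4) :
    ContDiffOn ℝ ∞ (d.matV i j) D := by
  have h1 := h.lam_smooth.mul h.nu_smooth
  have h2 := h.lam_smooth.mul h.mu_smooth
  have h3 : ContDiffOn ℝ ∞ (fun _ : ℝ × ℝ => (0 : ℝ)) D := contDiffOn_const
  fin_cases i <;> fin_cases j
  exacts [h.b_smooth, h.a_smooth, h3, h2, h.a_smooth, h.b_smooth, h1, h3, h3, h.nu_smooth.neg, h3,
    h.β₂_smooth, h.mu_smooth, h3, h.β₂_smooth.neg, h3]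

/-- `X` solves the derivation formulas with the coefficients `d`. -/
def IsSolution (d : FrameData) (D : Set (ℝ × ℝ)) (X : Fin 4 → ℝ × ℝ → R41) : Prop :=
  ∀ p ∈ D, ∀ i, HasPartials (X i) (∑ j, d.matU i j p • X j p) (∑ j, d.matV i j p • X j p) p

/-- The transition maps between two solutions are locally constant. -/
theorem IsSolution.hasPartials_transition (hd : d.IsRegular D) {X X' : Fin 4 → ℝ × ℝ → R41}
    (hX : d.IsSolution D X) (hX' : d.IsSolution D X') (w : R41) {p : ℝ × ℝ} (hp : p ∈ D) :
    HasPartials (fun q => transition (d.lam q) (fun i => X i q) (fun i => X' i q) w) 0 0 p := by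
  have hm : ∀ i, HasPartials (fun q => mink w (X i q)) _ _ p := fun i =>
    (HasPartials.const w p).mink (hX p hp i)
  have hl := hd.lam_partials p hp
  have hl0 : d.lam p ≠ 0 := (hd.lam_pos p hp).ne'
  have h0 := ((hm 0).div hl.neg (neg_ne_zero.2 hl0)).smul (hX' p hp 0)
  have h1 := ((hm 1).div hl hl0).smul (hX' p hp 1)
  have h2 := (hm 2).smul (hX' p hp 2)
  have h3 := (hm 3).smul (hX' p hp 3)
  have h := ((h0.add h1).add h2).add h3
  have e : (fun q => transition (d.lam q) (fun i => X i q) (fun i => X' i q) w) =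
      fun q => (mink w (X 0 q) / -d.lam q) • X' 0 q + (mink w (X 1 q) / d.lam q) • X' 1 q +
        mink w (X 2 q) • X' 2 q + mink w (X 3 q) • X' 3 q := by
    ext1 q
    simp [transition_apply, Fin.sum_univ_four, eps]
  rw [e]
  -- With ε the Gram matrix diag(-λ, λ, 1, 1), each coefficient matrix M satisfies M ε + ε Mᵀ = ∂ε.
  -- Hence the dual coefficients ⟨w, X i⟩/ε i vary by -Mᵀ, which cancels the variation of the `X'
  -- i`. Adaptedness of the frames plays no role, so the result can be used to prove it.
  refine h.congr ?_ ?_ <;>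
  · simp only [Fin.sum_univ_four, mink_zero_left, mink_add_right, mink_smul_right, matU, matV,
      Matrix.cons_val, zero_smul, add_zero, zero_add]
    ext k
    simp only [Pi.add_apply, Pi.smul_apply, smul_eq_mul, Pi.zero_apply]
    field_simp
    ring

end FrameData

end Frames

/-! ### The Gauss, Codazzi and Ricci equations. -/

section Integrability

open Set Metric

namespace FrameData

variable {d : FrameData} {D : Set (ℝ × ℝ)}

/-- `β₁` and `β₂` are the partial derivatives of the angle with cosine `lam * nu` and sine
`lam * mu`. -/
structure HasAngle (d : FrameData) (D : Set (ℝ × ℝ)) : Prop where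
  cos_partials : ∀ p ∈ D, HasPartials (fun q => d.lam q * d.nu q)
    (-(d.lam p * d.mu p * d.β₂ p)) (-(d.lam p * d.mu p * d.β₁ p)) p
  sin_partials : ∀ p ∈ D, HasPartials (fun q => d.lam q * d.mu q)
    (d.lam p * d.nu p * d.β₂ p) (d.lam p * d.nu p * d.β₁ p) p

/-- The integrability conditions of the derivation formulas. -/
structure IsIntegrable (d : FrameData) (D : Set (ℝ × ℝ)) : Prop extends d.HasAngle D where
  closed : ∀ p ∈ D, dv d.a p = du d.b p
  gauss : ∀ p ∈ D, du d.a p - dv d.b p = d.lam p * (d.mu p ^ 2 - d.nu p ^ 2)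
  ricci : ∀ p ∈ D, du d.β₂ p - dv d.β₁ p = 2 * d.lam p * d.mu p * d.nu p

/-- Compare entries of the compatibility condition: the mixed tangent-normal ones give the Codazzi
equations, which are the derivatives of cos θ = λν and sin θ = λμ; entry (0,0) gives closedness,
(0,1) Gauss, (2,3) Ricci. -/
theorem IsSolution.isIntegrable (hD : IsOpen D) (hd : d.IsRegular D) {X : Fin 4 → ℝ × ℝ → R41}
    (hX : d.IsSolution D X) (hs : ∀ i, ContDiffOn ℝ ∞ (X i) D)
    (ha : ∀ p ∈ D, IsAdapted (d.lam p) fun i => X i p) : d.IsIntegrable D := by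
  have key : ∀ p ∈ D, ∀ i k, dv (d.matU i k) p + ∑ j, d.matU i j p * d.matV j k p =
      du (d.matV i k) p + ∑ j, d.matV i j p * d.matU j k p := fun p hp i k =>
    matrix_integrable_of_solution hD hd.contDiffOn_matU hd.contDiffOn_matV hs hX hp
      ((ha p hp).linearIndependent (hd.lam_pos p hp).ne') i k
  have h0 : ∀ p, du (fun _ : ℝ × ℝ => (0 : ℝ)) p = 0 := fun p => (HasPartials.const (0 : ℝ) p).du
  have h0' : ∀ p, dv (fun _ : ℝ × ℝ => (0 : ℝ)) p = 0 := fun p => (HasPartials.const (0 : ℝ) p).dv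
  have hc : ∀ p ∈ D, DifferentiableAt ℝ (fun q => d.lam q * d.nu q) p := fun p hp =>
    differentiableAt_of_contDiffOn (hd.lam_smooth.mul hd.nu_smooth) hD hp
  have hs : ∀ p ∈ D, DifferentiableAt ℝ (fun q => d.lam q * d.mu q) p := fun p hp =>
    differentiableAt_of_contDiffOn (hd.lam_smooth.mul hd.mu_smooth) hD hp
  refine ⟨⟨fun p hp => .of_eq (hc p hp) ?_ ?_, fun p hp => .of_eq (hs p hp) ?_ ?_⟩,
    fun p hp => ?_, fun p hp => ?_, fun p hp => ?_⟩
  · have := key p hp 1 2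
    simp only [matU, matV, Matrix.cons_val, Fin.sum_univ_four, h0'] at this
    linear_combination -this
  · have := key p hp 0 2
    simp only [matU, matV, Matrix.cons_val, Fin.sum_univ_four, h0] at this
    linear_combination this
  · have := key p hp 0 3
    simp only [matU, matV, Matrix.cons_val, Fin.sum_univ_four, h0'] at this
    linear_combination -this
  · have := key p hp 1 3
    simp only [matU, matV, Matrix.cons_val, Fin.sum_univ_four, h0] at this
    linear_combination this
  · have := key p hp 0 0
    simp only [matU, matV, Matrix.cons_val, Fin.sum_univ_four] at this
    linear_combination this
  · have := key p hp 0 1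
    simp only [matU, matV, Matrix.cons_val, Fin.sum_univ_four] at this
    linear_combination -this
  · have := key p hp 2 3
    simp only [matU, matV, Matrix.cons_val, Fin.sum_univ_four] at this
    linear_combination -this

theorem HasAngle.nu_partials (h : d.HasAngle D) (hD : IsOpen D) (hd : d.IsRegular D) {p : ℝ × ℝ}
    (hp : p ∈ D) : HasPartials d.nu (-2 * d.a p * d.nu p - d.mu p * d.β₂ p)
      (-2 * d.b p * d.nu p - d.mu p * d.β₁ p) p := by
  have h0 := (hd.lam_pos p hp).ne'
  refine (((h.cos_partials p hp).div (hd.lam_partials p hp) h0).congr_on hD hp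
    fun q hq => ?_).congr ?_ ?_
  · simp [(hd.lam_pos q hq).ne']
  all_goals field_simp; ring

theorem HasAngle.mu_partials (h : d.HasAngle D) (hD : IsOpen D) (hd : d.IsRegular D) {p : ℝ × ℝ}
    (hp : p ∈ D) : HasPartials d.mu (-2 * d.a p * d.mu p + d.nu p * d.β₂ p)
      (-2 * d.b p * d.mu p + d.nu p * d.β₁ p) p := by
  have h0 := (hd.lam_pos p hp).ne'
  refine (((h.sin_partials p hp).div (hd.lam_partials p hp) h0).congr_on hD hp
    fun q hq => ?_).congr ?_ ?_
  · simp [(hd.lam_pos q hq).ne']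
  all_goals field_simp; ring

/-- The rows of z_u and z_v involve λν and λμ, those of n₁ and n₂ involve ν and μ alone; the
derivatives of the latter follow by dividing by λ, and then all sixteen entries reduce to the Gauss,
Codazzi and Ricci equations and closedness. -/
theorem IsIntegrable.matrix_integrable (h : d.IsIntegrable D) (hD : IsOpen D)
    (hd : d.IsRegular D) {p : ℝ × ℝ} (hp : p ∈ D) (i k : Fin 4) :
    dv (d.matU i k) p + ∑ j, d.matU i j p * d.matV j k p =
      du (d.matV i k) p + ∑ j, d.matV i j p * d.matU j k p := by
  have h0 := HasPartials.const (0 : ℝ) p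
  have hc := h.cos_partials p hp
  have hs := h.sin_partials p hp
  have hn := h.nu_partials hD hd hp
  have hm := h.mu_partials hD hd hp
  have hb1 := hasPartials_of_contDiffOn hd.β₁_smooth hD hp
  have hb2 := hasPartials_of_contDiffOn hd.β₂_smooth hD hp
  have e1 := h.closed p hp
  have e2 := h.gauss p hp
  have e3 := h.ricci p hp
  fin_cases i <;> fin_cases k <;>
  · simp [matU, matV, Fin.sum_univ_four, h0.du, h0.dv, hc.du, hc.dv, hs.du, hs.dv, hn.neg.du,
      hn.dv, hm.neg.dv, hm.du, hb1.neg.dv, hb2.neg.du]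
    grind

/-- The extension of a `4 × 4` system for the frame to a `5 × 5` system for the surface and its
frame. -/
def extendMat (e : Fin 4 → ℝ) (M : Fin 4 → Fin 4 → ℝ × ℝ → ℝ) : Fin 5 → Fin 5 → ℝ × ℝ → ℝ :=
  Fin.cases (Fin.cases (fun _ => 0) fun k _ => e k) fun i => Fin.cases (fun _ => 0) fun k => M i k

theorem contDiffOn_extendMat {e : Fin 4 → ℝ} {M : Fin 4 → Fin 4 → ℝ × ℝ → ℝ}
    (hM : ∀ i k, ContDiffOn ℝ ∞ (M i k) D) (i k : Fin 5) :
    ContDiffOn ℝ ∞ (extendMat e M i k) D := by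
  cases i using Fin.cases <;> cases k using Fin.cases
  exacts [contDiffOn_const, contDiffOn_const, contDiffOn_const, hM _ _]

/-- A surface with given integrable coefficients and given initial frame. -/
theorem IsIntegrable.exists_solution (h : d.IsIntegrable D) (hD : IsOpen D) (hd : d.IsRegular D)
    {p₀ : ℝ × ℝ} (hp₀ : p₀ ∈ D) (x₀ : Fin 4 → R41) :
    ∃ δ > 0, ball p₀ δ ⊆ D ∧ ∃ (z : ℝ × ℝ → R41) (X : Fin 4 → ℝ × ℝ → R41),
      (∀ i, X i p₀ = x₀ i) ∧ ContDiffOn ℝ ∞ z (ball p₀ δ) ∧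
      (∀ i, ContDiffOn ℝ ∞ (X i) (ball p₀ δ)) ∧
      (∀ p ∈ ball p₀ δ, HasPartials z (X 0 p) (X 1 p) p) ∧ d.IsSolution (ball p₀ δ) X := by
  obtain ⟨δ, hδ, hsub, Y, hY₀, hYs, hY⟩ := exists_solution_of_matrix_integrable
    (A := extendMat ![1, 0, 0, 0] d.matU) (B := extendMat ![0, 1, 0, 0] d.matV) hD
    (contDiffOn_extendMat hd.contDiffOn_matU) (contDiffOn_extendMat hd.contDiffOn_matV)
    (fun p hp i k => by
      have hc : ∀ c : ℝ, du (fun _ : ℝ × ℝ => c) p = 0 ∧ dv (fun _ : ℝ × ℝ => c) p = 0 :=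
        fun c => ⟨(HasPartials.const c p).du, (HasPartials.const c p).dv⟩
      have h4 := h.matrix_integrable hD hd hp
      cases i using Fin.cases with
      | zero =>
        cases k using Fin.cases with
        | zero => simp [extendMat, Fin.sum_univ_succ, hc]
        | succ k =>
          -- The new row is compatible because row 1 of U equals row 0 of V: both are the expansion
          -- of z_uv.
          simp only [extendMat, Fin.cases_zero, Fin.cases_succ, Fin.sum_univ_succ, hc]
          fin_cases k <;> simp [matU, matV]
      | succ i =>
        cases k using Fin.cases with
        | zero => simp [extendMat, Fin.sum_univ_succ, hc]
        | succ k => simpa [extendMat, Fin.sum_univ_succ] using h4 i k)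
    hp₀ (Fin.cons 0 x₀)
  refine ⟨δ, hδ, hsub, Y 0, fun i => Y i.succ, fun i => by simp [hY₀], hYs 0,
    fun i => hYs i.succ, fun p hp => ?_, fun p hp i => ?_⟩
  · refine (hY p hp 0).congr ?_ ?_ <;> simp [extendMat, Fin.sum_univ_succ]
  · refine (hY p hp i.succ).congr ?_ ?_ <;> simp [extendMat, Fin.sum_univ_succ]

end FrameData

end Integrability

/-! ### The natural equations as the Gauss and Ricci equations, and coefficients from curvatures. -/

section NaturalEquations

open Set Metric

/-- With c = cos θ, s = sin θ and θ_u = t₂, θ_v = t₁, the function is arctan(-tan 2θ), which is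
locally -2θ plus a constant. Working with c and s avoids choosing θ. -/
theorem hasPartials_arctan_double {c s : ℝ × ℝ → ℝ} {t₁ t₂ : ℝ} {p : ℝ × ℝ}
    (hc : HasPartials c (-(s p * t₂)) (-(s p * t₁)) p)
    (hs : HasPartials s (c p * t₂) (c p * t₁) p) (h1 : c p ^ 2 + s p ^ 2 = 1)
    (hQ : c p * c p - s p * s p ≠ 0) :
    HasPartials (fun q => Real.arctan (-2 * (c q * s q) / (c q * c q - s q * s q)))
      (-2 * t₂) (-2 * t₁) p := by
  -- This is 1 + tan² 2θ = 1/cos² 2θ.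
  have hx : 1 + (-2 * (c p * s p) / (c p * c p - s p * s p)) ^ 2 =
      1 / (c p * c p - s p * s p) ^ 2 := by
    rw [div_pow, eq_div_iff (pow_ne_zero 2 hQ), add_mul, div_mul_cancel₀ _ (pow_ne_zero 2 hQ)]
    linear_combination (c p ^ 2 + s p ^ 2 + 1) * h1
  refine ((((HasPartials.const (-2 : ℝ) p).mul (hc.mul hs)).div
    ((hc.mul hc).sub (hs.mul hs)) hQ).comp_hasDerivAt (Real.hasDerivAt_arctan _)).congr ?_ ?_ <;>
  · rw [hx, one_div_one_div, mul_div_cancel₀ _ (pow_ne_zero 2 hQ)]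
    first
    | linear_combination (-2 * t₂) * (c p ^ 2 + s p ^ 2 + 1) * h1
    | linear_combination (-2 * t₁) * (c p ^ 2 + s p ^ 2 + 1) * h1

/-- The functions `K` and `ϰ` are the curvatures belonging to the coefficients `d`. -/
structure FrameData.HasCurvatures (d : FrameData) (D : Set (ℝ × ℝ)) (K ϰ : ℝ × ℝ → ℝ) : Prop where
  gauss_eq : ∀ p ∈ D, K p = d.nu p ^ 2 - d.mu p ^ 2
  normal_eq : ∀ p ∈ D, ϰ p = -2 * d.nu p * d.mu p

variable {d : FrameData} {D : Set (ℝ × ℝ)} {K ϰ : ℝ × ℝ → ℝ} {p : ℝ × ℝ}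

namespace FrameData.HasCurvatures

/-- K² + ϰ² = (ν² + μ²)², and the canonical condition gives ν² + μ² = λ⁻². -/
theorem sq_add_sq (h : d.HasCurvatures D K ϰ) (hd : d.IsRegular D) (hp : p ∈ D) :
    K p ^ 2 + ϰ p ^ 2 = (d.lam p ^ 4)⁻¹ := by
  rw [h.gauss_eq p hp, h.normal_eq p hp]
  have h0 := (hd.lam_pos p hp).ne'
  refine eq_inv_of_mul_eq_one_left ?_
  have := hd.canon p hp
  linear_combination (d.lam p ^ 2 * (d.nu p ^ 2 + d.mu p ^ 2) + 1) * this

theorem rpow_one_div_four (h : d.HasCurvatures D K ϰ) (hd : d.IsRegular D) (hp : p ∈ D) :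
    (K p ^ 2 + ϰ p ^ 2) ^ (1 / 4 : ℝ) = (d.lam p)⁻¹ := by
  have h0 := hd.lam_pos p hp
  rw [h.sq_add_sq hd hp, ← inv_pow, ← Real.rpow_natCast, ← Real.rpow_mul (by positivity)]
  norm_num

theorem log_rpow (h : d.HasCurvatures D K ϰ) (hd : d.IsRegular D) (hp : p ∈ D) :
    Real.log ((K p ^ 2 + ϰ p ^ 2) ^ (1 / 8 : ℝ)) = -(1 / 2) * Real.log (d.lam p) := by
  have h0 := hd.lam_pos p hp
  rw [h.sq_add_sq hd hp, Real.log_rpow (by positivity), Real.log_inv, Real.log_pow]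
  push_cast
  ring

/-- The logarithm equals -½ ln λ, whose partial derivatives are -a and -b. -/
theorem hypLaplace_log (h : d.HasCurvatures D K ϰ) (hD : IsOpen D) (hd : d.IsRegular D)
    (hp : p ∈ D) :
    hypLaplace (fun q => Real.log ((K q ^ 2 + ϰ q ^ 2) ^ (1 / 8 : ℝ))) p =
      -(du d.a p - dv d.b p) := by
  have h1 : ∀ q ∈ D, HasPartials (fun q => Real.log ((K q ^ 2 + ϰ q ^ 2) ^ (1 / 8 : ℝ)))
      (-d.a q) (-d.b q) q := by
    intro q hq
    have h0 := (hd.lam_pos q hq).ne'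
    refine (((hd.lam_partials q hq).comp_hasDerivAt
      ((Real.hasDerivAt_log h0).const_mul (-(1 / 2)))).congr_on hD hq
      fun r hr => h.log_rpow hd hr).congr ?_ ?_ <;> field_simp
  rw [hypLaplace, du_congr_on hD (fun q hq => (h1 q hq).du) hp,
    dv_congr_on hD (fun q hq => (h1 q hq).dv) hp,
    (hasPartials_of_contDiffOn hd.a_smooth hD hp).neg.du,
    (hasPartials_of_contDiffOn hd.b_smooth hD hp).neg.dv]
  ring

theorem hypLaplace_arctan (h : d.HasCurvatures D K ϰ) (hD : IsOpen D) (hd : d.IsRegular D)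
    (ha : d.HasAngle D) (hp : p ∈ D) (hK : K p ≠ 0) :
    hypLaplace (fun q => Real.arctan (ϰ q / K q)) p = -2 * (du d.β₂ p - dv d.β₁ p) := by
  set c : ℝ × ℝ → ℝ := fun q => d.lam q * d.nu q with hc
  set s : ℝ × ℝ → ℝ := fun q => d.lam q * d.mu q with hs
  have hcs : ∀ q ∈ D, c q ^ 2 + s q ^ 2 = 1 := fun q hq => by
    have := hd.canon q hq
    simp only [hc, hs]
    linear_combination this
  have hcs' : ∀ q ∈ D, d.lam q ^ 2 * K q = c q * c q - s q * s q := fun q hq => by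
    rw [h.gauss_eq q hq]; simp only [hc, hs]; ring
  -- As λ²K = cos 2θ, this is the open part of the domain where K ≠ 0. The arctangent formula is
  -- needed on a neighbourhood of p in order to be differentiated twice.
  set D' : Set (ℝ × ℝ) := D ∩ {q | c q * c q - s q * s q ≠ 0} with hD'
  have hcont : ContinuousOn (fun q => c q * c q - s q * s q) D := by
    have hc' : ContinuousOn c D := (hd.lam_smooth.mul hd.nu_smooth).continuousOn
    have hs' : ContinuousOn s D := (hd.lam_smooth.mul hd.mu_smooth).continuousOn
    fun_prop
  have hDo : IsOpen D' := hcont.isOpen_inter_preimage hD isOpen_ne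
  have hpD' : p ∈ D' := by
    refine ⟨hp, ?_⟩
    have := (hd.lam_pos p hp).ne'
    simp only [mem_ofPred_eq, ← hcs' p hp]
    positivity
  have h1 : ∀ q ∈ D', HasPartials (fun q => Real.arctan (ϰ q / K q))
      (-2 * d.β₂ q) (-2 * d.β₁ q) q := by
    intro q hq
    refine (hasPartials_arctan_double (ha.cos_partials q hq.1) (ha.sin_partials q hq.1)
      (hcs q hq.1) hq.2).congr_on hDo hq fun r hr => ?_
    have hK' : K r ≠ 0 := by
      have := hr.2
      simp only [mem_ofPred_eq, ← hcs' r hr.1] at this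
      exact right_ne_zero_of_mul this
    have h3 := (hd.lam_pos r hr.1).ne'
    change Real.arctan (ϰ r / K r) =
      Real.arctan (-2 * (c r * s r) / (c r * c r - s r * s r))
    rw [← hcs' r hr.1, h.normal_eq r hr.1]
    congr 1
    simp only [hc, hs]
    field_simp
  have h2 := hd.β₂_smooth.mono (inter_subset_left : D' ⊆ D)
  have h3 := hd.β₁_smooth.mono (inter_subset_left : D' ⊆ D)
  rw [hypLaplace, du_congr_on hDo (fun q hq => (h1 q hq).du) hpD',
    dv_congr_on hDo (fun q hq => (h1 q hq).dv) hpD',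
    ((HasPartials.const (-2 : ℝ) p).mul (hasPartials_of_contDiffOn h2 hDo hpD')).du,
    ((HasPartials.const (-2 : ℝ) p).mul (hasPartials_of_contDiffOn h3 hDo hpD')).dv]
  ring

theorem naturalEq₁_iff (h : d.HasCurvatures D K ϰ) (hD : IsOpen D) (hd : d.IsRegular D)
    (hp : p ∈ D) : NaturalEq₁ K ϰ p ↔
      du d.a p - dv d.b p = d.lam p * (d.mu p ^ 2 - d.nu p ^ 2) := by
  have h0 := (hd.lam_pos p hp).ne'
  rw [NaturalEq₁, h.rpow_one_div_four hd hp, h.hypLaplace_log hD hd hp, h.gauss_eq p hp,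
    inv_mul_eq_iff_eq_mul₀ h0]
  constructor <;> intro h1 <;> linear_combination -h1

theorem naturalEq₂_iff (h : d.HasCurvatures D K ϰ) (hD : IsOpen D) (hd : d.IsRegular D)
    (ha : d.HasAngle D) (hp : p ∈ D) (hK : K p ≠ 0) : NaturalEq₂ K ϰ p ↔
      du d.β₂ p - dv d.β₁ p = 2 * d.lam p * d.mu p * d.nu p := by
  have h0 := (hd.lam_pos p hp).ne'
  rw [NaturalEq₂, h.rpow_one_div_four hd hp, h.hypLaplace_arctan hD hd ha hp hK,
    h.normal_eq p hp, inv_mul_eq_iff_eq_mul₀ h0]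
  constructor <;> intro h1
  · linear_combination -(1 / 2) * h1
  · linear_combination -2 * h1

end FrameData.HasCurvatures

/-- The coefficients of a canonical frame which belong to given curvatures. -/
theorem exists_frameData (hD : IsOpen D) (hK : ContDiffOn ℝ ∞ K D) (hϰ : ContDiffOn ℝ ∞ ϰ D)
    (h0 : ∀ p ∈ D, ϰ p ≠ 0) : ∃ d : FrameData, d.IsRegular D ∧ d.HasAngle D ∧
      d.HasCurvatures D K ϰ ∧ ∀ p ∈ D, dv d.a p = du d.b p := by
  -- W is to be ν² + μ²; with K = ν² - μ² this forces μ² = (W - K)/2 and ν² = (W + K)/2. As ϰ ≠ 0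
  -- gives W > K, the positive root μ is smooth, and ϰ = -2νμ then determines ν.
  obtain ⟨W, hW⟩ : ∃ W : ℝ × ℝ → ℝ, W = fun q => √(K q ^ 2 + ϰ q ^ 2) := ⟨_, rfl⟩
  have hpos : ∀ p ∈ D, 0 < K p ^ 2 + ϰ p ^ 2 := fun p hp => by
    have := h0 p hp
    positivity
  have hWpos : ∀ p ∈ D, 0 < W p := fun p hp => by rw [hW]; exact Real.sqrt_pos.2 (hpos p hp)
  have hWsq : ∀ p ∈ D, W p ^ 2 = K p ^ 2 + ϰ p ^ 2 := fun p hp => by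
    rw [hW]; exact Real.sq_sqrt (hpos p hp).le
  have hWK : ∀ p ∈ D, 0 < W p - K p := fun p hp => by
    have h1 := hWsq p hp
    have h2 := hWpos p hp
    have h3 : 0 < ϰ p ^ 2 := by
      have := h0 p hp
      positivity
    nlinarith
  have hWs : ContDiffOn ℝ ∞ W D := by
    rw [hW]
    exact ((hK.pow 2).add (hϰ.pow 2)).sqrt fun p hp => (hpos p hp).ne'
  obtain ⟨lam, hlam⟩ : ∃ lam : ℝ × ℝ → ℝ, lam = fun q => (√(W q))⁻¹ := ⟨_, rfl⟩
  have hlpos : ∀ p ∈ D, 0 < lam p := fun p hp => by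
    rw [hlam]; exact inv_pos.2 (Real.sqrt_pos.2 (hWpos p hp))
  have hlsq : ∀ p ∈ D, lam p ^ 2 * W p = 1 := fun p hp => by
    rw [hlam]
    simp only [inv_pow, Real.sq_sqrt (hWpos p hp).le]
    exact inv_mul_cancel₀ (hWpos p hp).ne'
  have hls : ContDiffOn ℝ ∞ lam D := by
    rw [hlam]
    exact (hWs.sqrt fun p hp => (hWpos p hp).ne').inv fun p hp =>
      (Real.sqrt_pos.2 (hWpos p hp)).ne'
  obtain ⟨mu, hmu⟩ : ∃ mu : ℝ × ℝ → ℝ, mu = fun q => √((W q - K q) / 2) := ⟨_, rfl⟩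
  have hmpos : ∀ p ∈ D, 0 < mu p := fun p hp => by
    rw [hmu]; exact Real.sqrt_pos.2 (half_pos (hWK p hp))
  have hmsq : ∀ p ∈ D, mu p ^ 2 = (W p - K p) / 2 := fun p hp => by
    rw [hmu]; exact Real.sq_sqrt (half_pos (hWK p hp)).le
  have hms : ContDiffOn ℝ ∞ mu D := by
    rw [hmu]
    exact ((hWs.sub hK).div_const 2).sqrt fun p hp => (half_pos (hWK p hp)).ne'
  obtain ⟨nu, hnu⟩ : ∃ nu : ℝ × ℝ → ℝ, nu = fun q => -ϰ q / (2 * mu q) := ⟨_, rfl⟩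
  have hnm : ∀ p ∈ D, ϰ p = -2 * nu p * mu p := fun p hp => by
    have := (hmpos p hp).ne'
    rw [hnu]
    field_simp
  have hns : ContDiffOn ℝ ∞ nu D := by
    rw [hnu]
    exact hϰ.neg.div (contDiffOn_const.mul hms) fun p hp => by
      have := (hmpos p hp).ne'
      positivity
  have hnsq : ∀ p ∈ D, nu p ^ 2 = (W p + K p) / 2 := fun p hp => by
    refine mul_right_cancel₀ (pow_ne_zero 2 (hmpos p hp).ne') ?_
    have h1 : ϰ p ^ 2 = W p ^ 2 - K p ^ 2 := by linear_combination -hWsq p hp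
    rw [hnm p hp] at h1
    linear_combination (1 / 4) * h1 - (W p + K p) / 2 * hmsq p hp
  obtain ⟨c, hc⟩ : ∃ c : ℝ × ℝ → ℝ, c = fun q => lam q * nu q := ⟨_, rfl⟩
  obtain ⟨s, hs⟩ : ∃ s : ℝ × ℝ → ℝ, s = fun q => lam q * mu q := ⟨_, rfl⟩
  have hcs : ContDiffOn ℝ ∞ c D := hc ▸ hls.mul hns
  have hss : ContDiffOn ℝ ∞ s D := hs ▸ hls.mul hms
  have hlp : ∀ p ∈ D, HasPartials lam _ _ p := fun p hp => hasPartials_of_contDiffOn hls hD hp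
  have hcp : ∀ p ∈ D, HasPartials c _ _ p := fun p hp => hasPartials_of_contDiffOn hcs hD hp
  have hsp : ∀ p ∈ D, HasPartials s _ _ p := fun p hp => hasPartials_of_contDiffOn hss hD hp
  have hcanon : ∀ p ∈ D, lam p ^ 2 * (nu p ^ 2 + mu p ^ 2) = 1 := fun p hp => by
    rw [hnsq p hp, hmsq p hp]
    linear_combination hlsq p hp
  have hone : ∀ p ∈ D, c p * c p + s p * s p = 1 := fun p hp => by
    rw [hc, hs]
    linear_combination hcanon p hp
  -- Differentiating c² + s² = 1 makes (c', s') orthogonal to (c, s), so c' = -s (c s' - s c') and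
  -- s' = c (c s' - s c'). The bracket is θ', which is how β₂ = θ_u and β₁ = θ_v are defined below
  -- without an angle.
  have hder : ∀ p ∈ D, HasPartials (fun q => c q * c q + s q * s q) 0 0 p := fun p hp =>
    (HasPartials.const (1 : ℝ) p).congr_on hD hp hone
  have hder' : ∀ p ∈ D, HasPartials (fun q => c q * c q + s q * s q) _ _ p := fun p hp =>
    ((hcp p hp).mul (hcp p hp)).add ((hsp p hp).mul (hsp p hp))
  have hu : ∀ p ∈ D, c p * du c p + s p * du s p = 0 := fun p hp => by
    have := (hder' p hp).du.symm.trans (hder p hp).du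
    linear_combination (1 / 2) * this
  have hv : ∀ p ∈ D, c p * dv c p + s p * dv s p = 0 := fun p hp => by
    have := (hder' p hp).dv.symm.trans (hder p hp).dv
    linear_combination (1 / 2) * this
  have hlu := contDiffOn_du hls hD
  have hlv := contDiffOn_dv hls hD
  have h2l : ContDiffOn ℝ ∞ (fun q => 2 * lam q) D := contDiffOn_const.mul hls
  have h2l0 : ∀ p ∈ D, 2 * lam p ≠ 0 := fun p hp => by
    have := (hlpos p hp).ne'
    positivity
  refine ⟨⟨lam, nu, mu, fun q => du lam q / (2 * lam q), fun q => dv lam q / (2 * lam q),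
    fun q => c q * dv s q - s q * dv c q, fun q => c q * du s q - s q * du c q⟩,
    ⟨hls, hns, hms, hlu.div h2l h2l0, hlv.div h2l h2l0,
      (hcs.mul (contDiffOn_dv hss hD)).sub (hss.mul (contDiffOn_dv hcs hD)),
      (hcs.mul (contDiffOn_du hss hD)).sub (hss.mul (contDiffOn_du hcs hD)),
      hlpos, hcanon, fun p hp h => ?_, fun p hp => (hmpos p hp).ne', fun p hp => ?_⟩,
    ⟨fun p hp => ?_, fun p hp => ?_⟩, ⟨fun p hp => ?_, hnm⟩, fun p hp => ?_⟩
  · refine h0 p hp ?_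
    simp only at h
    rw [hnm p hp, h]
    ring
  · have := (hlpos p hp).ne'
    refine (hlp p hp).congr ?_ ?_ <;> simp only <;> field_simp
  · have e1 : lam p * mu p = s p := by rw [hs]
    have h1 := hone p hp
    simp only [e1]
    rw [← hc]
    refine (hcp p hp).congr ?_ ?_
    · linear_combination -du c p * h1 + c p * hu p hp
    · linear_combination -dv c p * h1 + c p * hv p hp
  · have e1 : lam p * nu p = c p := by rw [hc]
    have h1 := hone p hp
    simp only [e1]
    rw [← hs]
    refine (hsp p hp).congr ?_ ?_
    · linear_combination -du s p * h1 + s p * hu p hp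
    · linear_combination -dv s p * h1 + s p * hv p hp
  · simp only
    rw [hnsq p hp, hmsq p hp]
    ring
  · have h2 := (HasPartials.const (2 : ℝ) p).mul (hlp p hp)
    change dv (fun q => du lam q / (2 * lam q)) p = du (fun q => dv lam q / (2 * lam q)) p
    rw [((hasPartials_of_contDiffOn hlu hD hp).div h2 (h2l0 p hp)).dv,
      ((hasPartials_of_contDiffOn hlv hD hp).div h2 (h2l0 p hp)).du, dv_du_eq_du_dv hls hD hp]
    ring

end NaturalEquations

/-! ### Second fundamental form and curvatures in terms of the frame coefficients. -/

section Surfaces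

open Set Metric

variable {d : FrameData} {D : Set (ℝ × ℝ)} {z n₁ n₂ : ℝ × ℝ → R41} {p : ℝ × ℝ}

/-- The frame field `z_u, z_v, n₁, n₂`. -/
noncomputable def frameField (z n₁ n₂ : ℝ × ℝ → R41) : Fin 4 → ℝ × ℝ → R41 := ![du z, dv z, n₁, n₂]

/-- `z_u, z_v, n₁, n₂` is a positively oriented frame field along the surface `z`, which satisfies
the derivation formulas with the coefficients `d`. -/
structure IsFrame (d : FrameData) (D : Set (ℝ × ℝ)) (z n₁ n₂ : ℝ × ℝ → R41) : Prop where
  smooth : ContDiffOn ℝ ∞ z D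
  smooth₁ : ContDiffOn ℝ ∞ n₁ D
  smooth₂ : ContDiffOn ℝ ∞ n₂ D
  adapted : ∀ p ∈ D, IsAdapted (d.lam p) fun i => frameField z n₁ n₂ i p
  solution : d.IsSolution D (frameField z n₁ n₂)
  oriented : ∀ p ∈ D, 0 < (Matrix.of fun i => frameField z n₁ n₂ i p).det

theorem frameField_apply (z n₁ n₂ : ℝ × ℝ → R41) (p : ℝ × ℝ) :
    (fun i => frameField z n₁ n₂ i p) = ![du z p, dv z p, n₁ p, n₂ p] := by
  ext1 i
  fin_cases i <;> rfl

theorem tangentPart_smul (r : ℝ) (w : R41) :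
    tangentPart z p (r • w) = r • tangentPart z p w := by
  simp only [tangentPart, mink_smul_left, smul_add, smul_smul]
  congr 2 <;> ring

theorem tangentPart_add (w w' : R41) :
    tangentPart z p (w + w') = tangentPart z p w + tangentPart z p w' := by
  simp only [tangentPart, mink_add_left]
  ext i
  simp only [Pi.add_apply, Pi.smul_apply, smul_eq_mul]
  ring

theorem normalPart_smul (r : ℝ) (w : R41) : normalPart z p (r • w) = r • normalPart z p w := by
  rw [normalPart, normalPart, tangentPart_smul, smul_sub]

theorem normalPart_add (w w' : R41) :
    normalPart z p (w + w') = normalPart z p w + normalPart z p w' := by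
  rw [normalPart, normalPart, normalPart, tangentPart_add]
  abel

/-- In `sff` the directions are constant coordinate vectors, so scaling them needs no derivative of
the factors. This passes between z_u, z_v and the unit vectors x, y at a point. -/
theorem sff_smul_smul (s t : ℝ) (e f : ℝ × ℝ) :
    sff z p (s • e) (t • f) = (s * t) • sff z p e f := by
  have h : fderiv ℝ (fun q => fderiv ℝ z q (t • f)) p (s • e) =
      (s * t) • fderiv ℝ (fun q => fderiv ℝ z q f) p e := by
    simp only [map_smul]
    have := congrFun (fderiv_const_smul_field (𝕜 := ℝ) t (f := fun q => fderiv ℝ z q f)) p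
    rw [show (fun q => t • fderiv ℝ z q f) = t • fun q => fderiv ℝ z q f from rfl, this,
      Pi.smul_apply, smul_apply, smul_smul]
  rw [sff, h, normalPart_smul]
  rfl

theorem normalPart_of_mink_eq_zero {w : R41} (hu : mink w (du z p) = 0)
    (hv : mink w (dv z p) = 0) : normalPart z p w = w := by
  simp [normalPart, tangentPart, hu, hv]

theorem normalPart_du (hF : FF z p = 0) (hE : EE z p ≠ 0) (hG : GG z p ≠ 0) :
    normalPart z p (du z p) = 0 := by
  have h1 : mink (du z p) (du z p) = EE z p := rfl
  have h2 : mink (du z p) (dv z p) = 0 := hF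
  rw [normalPart, tangentPart, h1, h2, hF]
  have : GG z p * EE z p / (EE z p * GG z p) = 1 := by field_simp
  simp [this]

theorem normalPart_dv (hF : FF z p = 0) (hE : EE z p ≠ 0) (hG : GG z p ≠ 0) :
    normalPart z p (dv z p) = 0 := by
  have h1 : mink (dv z p) (dv z p) = GG z p := rfl
  have h2 : mink (dv z p) (du z p) = 0 := (mink_comm _ _).trans hF
  rw [normalPart, tangentPart, h1, h2, hF]
  have : EE z p * GG z p / (EE z p * GG z p) = 1 := by field_simp
  simp [this]

theorem isAdapted_of_isNormalBasis {l : ℝ} {e₁ e₂ : R41} (h : IsNormalBasis z p e₁ e₂)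
    (hE : EE z p = -l) (hF : FF z p = 0) (hG : GG z p = l) :
    IsAdapted l ![du z p, dv z p, e₁, e₂] := by
  have hF' : mink (dv z p) (du z p) = 0 := (mink_comm _ _).trans hF
  have h1 := (mink_comm (du z p) e₁).trans h.normal₁u
  have h2 := (mink_comm (dv z p) e₁).trans h.normal₁v
  have h3 := (mink_comm (du z p) e₂).trans h.normal₂u
  have h4 := (mink_comm (dv z p) e₂).trans h.normal₂v
  have h5 := (mink_comm e₂ e₁).trans h.orth
  intro i j
  fin_cases i <;> fin_cases j
  exacts [hE, hF, h1, h3, hF', hG, h2, h4, h.normal₁u, h.normal₁v, h.unit₁, h.orth, h.normal₂u,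
    h.normal₂v, h5, h.unit₂]

namespace IsFrame

theorem adapted' (h : IsFrame d D z n₁ n₂) (hp : p ∈ D) :
    IsAdapted (d.lam p) ![du z p, dv z p, n₁ p, n₂ p] := by
  rw [← frameField_apply]
  exact h.adapted p hp

theorem EE_eq (h : IsFrame d D z n₁ n₂) (hp : p ∈ D) : EE z p = -d.lam p := h.adapted' hp 0 0

theorem FF_eq (h : IsFrame d D z n₁ n₂) (hp : p ∈ D) : FF z p = 0 := h.adapted' hp 0 1

theorem GG_eq (h : IsFrame d D z n₁ n₂) (hp : p ∈ D) : GG z p = d.lam p := h.adapted' hp 1 1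

theorem isNormalBasis (h : IsFrame d D z n₁ n₂) (hp : p ∈ D) :
    IsNormalBasis z p (n₁ p) (n₂ p) :=
  have ha := h.adapted' hp
  ⟨ha 2 0, ha 2 1, ha 3 0, ha 3 1, ha 2 2, ha 3 3, ha 2 3⟩

theorem du_partials (h : IsFrame d D z n₁ n₂) (hp : p ∈ D) : HasPartials (du z)
    (d.a p • du z p + d.b p • dv z p + (d.lam p * d.nu p) • n₁ p)
    (d.b p • du z p + d.a p • dv z p + (d.lam p * d.mu p) • n₂ p) p := by
  refine (h.solution p hp 0).congr ?_ ?_ <;>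
    simp [FrameData.matU, FrameData.matV, frameField, Fin.sum_univ_four]

theorem dv_partials (h : IsFrame d D z n₁ n₂) (hp : p ∈ D) : HasPartials (dv z)
    (d.b p • du z p + d.a p • dv z p + (d.lam p * d.mu p) • n₂ p)
    (d.a p • du z p + d.b p • dv z p + (d.lam p * d.nu p) • n₁ p) p := by
  refine (h.solution p hp 1).congr ?_ ?_ <;>
    simp [FrameData.matU, FrameData.matV, frameField, Fin.sum_univ_four]

theorem n₁_partials (h : IsFrame d D z n₁ n₂) (hp : p ∈ D) : HasPartials n₁
    (d.nu p • du z p + d.β₁ p • n₂ p) (-d.nu p • dv z p + d.β₂ p • n₂ p) p := by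
  refine (h.solution p hp 2).congr ?_ ?_ <;>
    simp [FrameData.matU, FrameData.matV, frameField, Fin.sum_univ_four]

theorem n₂_partials (h : IsFrame d D z n₁ n₂) (hp : p ∈ D) : HasPartials n₂
    (-d.mu p • dv z p + -d.β₁ p • n₁ p) (d.mu p • du z p + -d.β₂ p • n₁ p) p := by
  refine (h.solution p hp 3).congr ?_ ?_ <;>
    simp [FrameData.matU, FrameData.matV, frameField, Fin.sum_univ_four]

variable (h : IsFrame d D z n₁ n₂) (hd : d.IsRegular D) (hp : p ∈ D)
include h hd hp

theorem normalPart_comb (x y s t : ℝ) :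
    normalPart z p (x • du z p + y • dv z p + s • n₁ p + t • n₂ p) = s • n₁ p + t • n₂ p := by
  have h0 := (hd.lam_pos p hp).ne'
  have hE : EE z p ≠ 0 := by rw [h.EE_eq hp]; simpa using h0
  have hG : GG z p ≠ 0 := by rw [h.GG_eq hp]; exact h0
  have hb := h.isNormalBasis hp
  simp only [normalPart_add, normalPart_smul, normalPart_du (h.FF_eq hp) hE hG,
    normalPart_dv (h.FF_eq hp) hE hG, normalPart_of_mink_eq_zero hb.normal₁u hb.normal₁v,
    normalPart_of_mink_eq_zero hb.normal₂u hb.normal₂v]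
  simp

theorem sff_uu : sff z p (1, 0) (1, 0) = (d.lam p * d.nu p) • n₁ p := by
  change normalPart z p (du (du z) p) = _
  rw [(h.du_partials hp).du]
  simpa using h.normalPart_comb hd hp (d.a p) (d.b p) (d.lam p * d.nu p) 0

theorem sff_uv : sff z p (1, 0) (0, 1) = (d.lam p * d.mu p) • n₂ p := by
  change normalPart z p (du (dv z) p) = _
  rw [(h.dv_partials hp).du]
  simpa using h.normalPart_comb hd hp (d.b p) (d.a p) 0 (d.lam p * d.mu p)

theorem sff_vv : sff z p (0, 1) (0, 1) = (d.lam p * d.nu p) • n₁ p := by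
  change normalPart z p (dv (dv z) p) = _
  rw [(h.dv_partials hp).dv]
  simpa using h.normalPart_comb hd hp (d.a p) (d.b p) (d.lam p * d.nu p) 0

theorem gaussCurvature_eq : gaussCurvature z p = d.nu p ^ 2 - d.mu p ^ 2 := by
  have hb := h.isNormalBasis hp
  have h0 := (hd.lam_pos p hp).ne'
  rw [gaussCurvature, h.sff_uu hd hp, h.sff_uv hd hp, h.sff_vv hd hp, h.EE_eq hp, h.FF_eq hp,
    h.GG_eq hp]
  simp only [mink_smul_left, mink_smul_right, hb.unit₁, hb.unit₂]
  field_simp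
  ring

/-- D_u n₂ = -β₁ n₁ and D_v n₂ = -β₂ n₁. In the second derivatives the n₂-components β₁β₂ are
orthogonal to n₁, the coordinate fields commute, and √(F² - EG) = λ. -/
theorem normalCurvature_eq (hD : IsOpen D) :
    normalCurvature z n₁ n₂ p = -(du d.β₂ p - dv d.β₁ p) / d.lam p := by
  have hl := hd.lam_pos p hp
  have hb := h.isNormalBasis hp
  have hY : EqOn (normalConn z (fun _ => (0, 1)) n₂) (fun q => -d.β₂ q • n₁ q) D := by
    intro q hq
    change normalPart z q (dv n₂ q) = _
    rw [(h.n₂_partials hq).dv]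
    simpa using h.normalPart_comb hd hq (d.mu q) 0 (-d.β₂ q) 0
  have hX : EqOn (normalConn z (fun _ => (1, 0)) n₂) (fun q => -d.β₁ q • n₁ q) D := by
    intro q hq
    change normalPart z q (du n₂ q) = _
    rw [(h.n₂_partials hq).du]
    simpa using h.normalPart_comb hd hq 0 (-d.mu q) (-d.β₁ q) 0
  have hXY : normalConn z (fun _ => (1, 0)) (normalConn z (fun _ => (0, 1)) n₂) p =
      -du d.β₂ p • n₁ p + (-d.β₂ p * d.β₁ p) • n₂ p := by
    change normalPart z p (du (normalConn z (fun _ => (0, 1)) n₂) p) = _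
    rw [(((hasPartials_of_contDiffOn hd.β₂_smooth hD hp).neg.smul
      (h.n₁_partials hp)).congr_on hD hp hY).du]
    -- The inserted z_u-coefficient is the tangential part of -β₂ ∂_u n₁, which the normal
    -- projection discards.
    rw [← h.normalPart_comb hd hp (-d.β₂ p * d.nu p) 0]
    congr 1
    module
  have hYX : normalConn z (fun _ => (0, 1)) (normalConn z (fun _ => (1, 0)) n₂) p =
      -dv d.β₁ p • n₁ p + (-d.β₁ p * d.β₂ p) • n₂ p := by
    change normalPart z p (dv (normalConn z (fun _ => (1, 0)) n₂) p) = _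
    rw [(((hasPartials_of_contDiffOn hd.β₁_smooth hD hp).neg.smul
      (h.n₁_partials hp)).congr_on hD hp hX).dv]
    rw [← h.normalPart_comb hd hp 0 (d.β₁ p * d.nu p)]
    congr 1
    module
  have hbr : normalConn z (VectorField.lieBracket ℝ (fun _ => ((1 : ℝ), (0 : ℝ)))
      (fun _ => ((0 : ℝ), (1 : ℝ)))) n₂ p = 0 := by
    have : normalPart z p 0 = 0 := by simpa using normalPart_smul (z := z) (p := p) 0 0
    simp [normalConn, VectorField.lieBracket, this]
  rw [normalCurvature, normalCurvatureOp, hXY, hYX, hbr, h.EE_eq hp, h.FF_eq hp, h.GG_eq hp]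
  have e1 : √(0 ^ 2 - -d.lam p * d.lam p) = d.lam p := by
    rw [show (0 : ℝ) ^ 2 - -d.lam p * d.lam p = d.lam p ^ 2 by ring, Real.sqrt_sq hl.le]
  have h21 : mink (n₂ p) (n₁ p) = 0 := (mink_comm _ _).trans hb.orth
  rw [e1, sub_zero, sub_eq_add_neg, mink_add_left, mink_neg_left, mink_add_left, mink_add_left]
  simp only [mink_smul_left, hb.unit₁, h21]
  ring

end IsFrame

end Surfaces

/-! ### Equivalence of canonical surfaces with frames solving the derivation formulas. -/

section CanonicalSurfaces

open Set Metric

variable {d : FrameData} {D : Set (ℝ × ℝ)} {z n₁ n₂ : ℝ × ℝ → R41} {p : ℝ × ℝ}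

/-- Tangential components are invisible to a normal vector, so the flatness determinants, defined
with second derivatives of z, can be computed from σ. -/
theorem mink_normalPart {e : R41} (hu : mink e (du z p) = 0) (hv : mink e (dv z p) = 0)
    (w : R41) : mink (normalPart z p w) e = mink w e := by
  rw [normalPart, tangentPart, sub_eq_add_neg, mink_add_left, mink_neg_left, mink_add_left,
    mink_smul_left, mink_smul_left, mink_comm (du z p), mink_comm (dv z p), hu, hv]
  ring

theorem unitX_eq {l : ℝ} (hE : EE z p = -l) : unitX z p = (1 / √l) • ((1, 0) : ℝ × ℝ) := by
  simp [unitX, hE]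

theorem unitY_eq {l : ℝ} (hG : GG z p = l) : unitY z p = (1 / √l) • ((0, 1) : ℝ × ℝ) := by
  simp [unitY, hG]

theorem one_div_sqrt_mul_self {l : ℝ} (hl : 0 < l) : 1 / √l * (1 / √l) = l⁻¹ := by
  rw [div_mul_div_comm, Real.mul_self_sqrt hl.le, one_mul, one_div]

/-- The mean curvature vanishes because E = -G, F = 0 and σ(z_u, z_u) = σ(z_v, z_v). In the frame
n₁, n₂ the first flatness determinant is λ²νμ ≠ 0. -/
theorem IsFrame.isCanonicalZMCSurface (h : IsFrame d D z n₁ n₂) (hd : d.IsRegular D) :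
    IsCanonicalZMCSurface z D n₁ n₂ := by
  have hsq : ∀ p ∈ D, 1 / √(d.mu p ^ 2 + d.nu p ^ 2) = d.lam p := fun p hp => by
    have hl := hd.lam_pos p hp
    have e : d.mu p ^ 2 + d.nu p ^ 2 = (d.lam p)⁻¹ ^ 2 := by
      rw [inv_pow]
      refine eq_inv_of_mul_eq_one_left ?_
      linear_combination hd.canon p hp
    rw [e, Real.sqrt_sq (inv_pos.2 hl).le, one_div, inv_inv]
  have hunit : ∀ p ∈ D, ∀ (r : ℝ) (n : R41), (1 / √(d.lam p) * (1 / √(d.lam p))) •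
      (d.lam p * r) • n = r • n := fun p hp r n => by
    rw [one_div_sqrt_mul_self (hd.lam_pos p hp), smul_smul,
      inv_mul_cancel_left₀ (hd.lam_pos p hp).ne']
  refine ⟨⟨h.smooth, fun p hp => ?_, fun p hp => ?_⟩, fun p hp => ?_, fun p hp hflat => ?_,
    d.nu, d.mu, ⟨⟨h.smooth₁, h.smooth₂, fun p hp => h.isNormalBasis hp, fun p hp => ?_⟩,
      fun p hp => h.FF_eq hp, fun p hp => ?_, fun p hp => ?_, fun p hp => ?_⟩,
    fun p hp => ?_, fun p hp => ?_⟩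
  · rw [h.EE_eq hp]; exact neg_neg_of_pos (hd.lam_pos p hp)
  · rw [h.GG_eq hp]; exact hd.lam_pos p hp
  · rw [meanCurvature, h.sff_uu hd hp, h.sff_uv hd hp, h.sff_vv hd hp, h.EE_eq hp, h.FF_eq hp,
      h.GG_eq hp]
    simp
  · have hb := h.isNormalBasis hp
    have h1 := (hflat _ _ hb).1
    have h2 : mink (du (du z) p) (n₁ p) = d.lam p * d.nu p := by
      rw [← mink_normalPart hb.normal₁u hb.normal₁v]
      change mink (sff z p (1, 0) (1, 0)) _ = _
      rw [h.sff_uu hd hp, mink_smul_left, hb.unit₁, mul_one]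
    have h3 : mink (du (du z) p) (n₂ p) = 0 := by
      rw [← mink_normalPart hb.normal₂u hb.normal₂v]
      change mink (sff z p (1, 0) (1, 0)) _ = _
      rw [h.sff_uu hd hp, mink_smul_left, hb.orth, mul_zero]
    have h4 : mink (du (dv z) p) (n₂ p) = d.lam p * d.mu p := by
      rw [← mink_normalPart hb.normal₂u hb.normal₂v]
      change mink (sff z p (1, 0) (0, 1)) _ = _
      rw [h.sff_uv hd hp, mink_smul_left, hb.unit₂, mul_one]
    rw [h2, h3, h4, mul_zero, sub_zero] at h1
    have := hd.lam_pos p hp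
    have := hd.nu_ne p hp
    have := hd.mu_ne p hp
    exact (by positivity : d.lam p * d.nu p * (d.lam p * d.mu p) ≠ 0) h1
  · rw [← frameField_apply]; exact h.oriented p hp
  · rw [unitX_eq (h.EE_eq hp), sff_smul_smul, h.sff_uu hd hp, hunit p hp]
  · rw [unitX_eq (h.EE_eq hp), unitY_eq (h.GG_eq hp), sff_smul_smul, h.sff_uv hd hp, hunit p hp]
  · rw [unitY_eq (h.GG_eq hp), sff_smul_smul, h.sff_vv hd hp, hunit p hp]
  · rw [h.EE_eq hp, hsq p hp]
  · rw [h.GG_eq hp, hsq p hp]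

/-- The derivation formulas of a surface in canonical parameters. -/
theorem IsCanonicalZMCSurface.exists_isFrame (h : IsCanonicalZMCSurface z D n₁ n₂)
    (hD : IsOpen D) : ∃ d : FrameData, d.IsRegular D ∧ IsFrame d D z n₁ n₂ := by
  obtain ⟨nu, mu, hc⟩ := h.canonical
  have hz := h.timelike.smooth
  have hb := hc.frame.basis
  have hs1 := hc.frame.smooth₁
  have hs2 := hc.frame.smooth₂
  obtain ⟨lam, hlam⟩ : ∃ lam : ℝ × ℝ → ℝ, lam = GG z := ⟨_, rfl⟩
  have hzu := contDiffOn_du hz hD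
  have hzv := contDiffOn_dv hz hD
  have hls : ContDiffOn ℝ ∞ lam D := hlam ▸ contDiffOn_mink hzv hzv
  have hl : ∀ p ∈ D, 0 < lam p := fun p hp => hlam ▸ h.timelike.G_pos p hp
  have hG : ∀ p ∈ D, GG z p = lam p := fun p _ => by rw [hlam]
  have hE : ∀ p ∈ D, EE z p = -lam p := fun p hp => by
    rw [hc.E_eq p hp, hlam, hc.G_eq p hp]
  have hF := hc.F_zero
  have hcanon : ∀ p ∈ D, lam p ^ 2 * (nu p ^ 2 + mu p ^ 2) = 1 := fun p hp => by
    have h1 := hc.G_eq p hp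
    have h2 := hl p hp
    rw [hG p hp] at h1
    have h3 : 0 < √(mu p ^ 2 + nu p ^ 2) := by
      rw [h1] at h2
      exact one_div_pos.1 h2
    have h4 := Real.sq_sqrt (Real.sqrt_pos.1 h3).le
    rw [h1, div_pow, h4, add_comm (nu p ^ 2), one_pow,
      one_div_mul_cancel (Real.sqrt_pos.1 h3).ne']
  have hnuu : ∀ p ∈ D, normalPart z p (du (du z) p) = (lam p * nu p) • n₁ p := fun p hp => by
    have h1 := hc.sff_xx p hp
    rw [unitX_eq (hE p hp), sff_smul_smul, one_div_sqrt_mul_self (hl p hp)] at h1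
    rw [mul_smul, ← h1, smul_inv_smul₀ (hl p hp).ne']
    rfl
  have hnuv : ∀ p ∈ D, normalPart z p (du (dv z) p) = (lam p * mu p) • n₂ p := fun p hp => by
    have h1 := hc.sff_xy p hp
    rw [unitX_eq (hE p hp), unitY_eq (hG p hp), sff_smul_smul,
      one_div_sqrt_mul_self (hl p hp)] at h1
    rw [mul_smul, ← h1, smul_inv_smul₀ (hl p hp).ne']
    rfl
  have hnvv : ∀ p ∈ D, normalPart z p (dv (dv z) p) = (lam p * nu p) • n₁ p := fun p hp => by
    have h1 := hc.sff_yy p hp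
    rw [unitY_eq (hG p hp), sff_smul_smul, one_div_sqrt_mul_self (hl p hp)] at h1
    rw [mul_smul, ← h1, smul_inv_smul₀ (hl p hp).ne']
    rfl
  -- In any normal basis the first and third determinants are ±λ²νμ times the determinant of the
  -- change of basis, and the second vanishes since z_uu and z_vv have equal normal parts. Thus νμ =
  -- 0 would make p flat.
  have hflat : ∀ p ∈ D, nu p * mu p ≠ 0 := by
    intro p hp h0
    refine h.no_flat p hp fun e₁ e₂ he => ?_
    have hm : ∀ e, mink e (du z p) = 0 → mink e (dv z p) = 0 →
        mink (du (du z) p) e = lam p * nu p * mink (n₁ p) e ∧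
        mink (du (dv z) p) e = lam p * mu p * mink (n₂ p) e ∧
        mink (dv (dv z) p) e = lam p * nu p * mink (n₁ p) e := by
      intro e hu hv
      rw [← mink_normalPart hu hv, ← mink_normalPart hu hv (du (dv z) p),
        ← mink_normalPart hu hv (dv (dv z) p), hnuu p hp, hnuv p hp, hnvv p hp]
      simp only [mink_smul_left, and_self]
    obtain ⟨a1, a2, a3⟩ := hm e₁ he.normal₁u he.normal₁v
    obtain ⟨b1, b2, b3⟩ := hm e₂ he.normal₂u he.normal₂v
    rw [a1, a2, a3, b1, b2, b3]
    refine ⟨?_, ?_, ?_⟩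
    · linear_combination (lam p ^ 2 * (mink (n₁ p) e₁ * mink (n₂ p) e₂ -
        mink (n₂ p) e₁ * mink (n₁ p) e₂)) * h0
    · ring
    · linear_combination (-lam p ^ 2 * (mink (n₁ p) e₁ * mink (n₂ p) e₂ -
        mink (n₂ p) e₁ * mink (n₁ p) e₂)) * h0
  have huu1 : ∀ p ∈ D, mink (du (du z) p) (n₁ p) = lam p * nu p := fun p hp => by
    rw [← mink_normalPart (hb p hp).normal₁u (hb p hp).normal₁v, hnuu p hp, mink_smul_left,
      (hb p hp).unit₁, mul_one]
  have huu2 : ∀ p ∈ D, mink (du (du z) p) (n₂ p) = 0 := fun p hp => by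
    rw [← mink_normalPart (hb p hp).normal₂u (hb p hp).normal₂v, hnuu p hp, mink_smul_left,
      (hb p hp).orth, mul_zero]
  have huv1 : ∀ p ∈ D, mink (du (dv z) p) (n₁ p) = 0 := fun p hp => by
    rw [← mink_normalPart (hb p hp).normal₁u (hb p hp).normal₁v, hnuv p hp, mink_smul_left,
      mink_comm, (hb p hp).orth, mul_zero]
  have huv2 : ∀ p ∈ D, mink (du (dv z) p) (n₂ p) = lam p * mu p := fun p hp => by
    rw [← mink_normalPart (hb p hp).normal₂u (hb p hp).normal₂v, hnuv p hp, mink_smul_left,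
      (hb p hp).unit₂, mul_one]
  have hvv1 : ∀ p ∈ D, mink (dv (dv z) p) (n₁ p) = lam p * nu p := fun p hp => by
    rw [← mink_normalPart (hb p hp).normal₁u (hb p hp).normal₁v, hnvv p hp, mink_smul_left,
      (hb p hp).unit₁, mul_one]
  have hvv2 : ∀ p ∈ D, mink (dv (dv z) p) (n₂ p) = 0 := fun p hp => by
    rw [← mink_normalPart (hb p hp).normal₂u (hb p hp).normal₂v, hnvv p hp, mink_smul_left,
      (hb p hp).orth, mul_zero]
  have hl0 : ∀ p ∈ D, lam p ≠ 0 := fun p hp => (hl p hp).ne'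
  -- ν and μ are given only as functions; their smoothness comes from ⟨z_uu, n₁⟩ = λν and ⟨z_uv, n₂⟩
  -- = λμ.
  have hns : ContDiffOn ℝ ∞ nu D :=
    ((contDiffOn_mink (contDiffOn_du hzu hD) hs1).div hls hl0).congr fun p hp => by
      change nu p = mink (du (du z) p) (n₁ p) / lam p
      rw [huu1 p hp, mul_div_cancel_left₀ _ (hl0 p hp)]
  have hms : ContDiffOn ℝ ∞ mu D :=
    ((contDiffOn_mink (contDiffOn_du hzv hD) hs2).div hls hl0).congr fun p hp => by
      change mu p = mink (du (dv z) p) (n₂ p) / lam p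
      rw [huv2 p hp, mul_div_cancel_left₀ _ (hl0 p hp)]
  have h2l : ContDiffOn ℝ ∞ (fun q => 2 * lam q) D := contDiffOn_const.mul hls
  have h2l0 : ∀ p ∈ D, 2 * lam p ≠ 0 := fun p hp => by
    have := hl0 p hp
    positivity
  have hlp : ∀ p ∈ D, HasPartials lam _ _ p := fun p hp => hasPartials_of_contDiffOn hls hD hp
  refine ⟨⟨lam, nu, mu, fun q => du lam q / (2 * lam q), fun q => dv lam q / (2 * lam q),
    fun q => mink (du n₁ q) (n₂ q), fun q => mink (dv n₁ q) (n₂ q)⟩,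
    ⟨hls, hns, hms, (contDiffOn_du hls hD).div h2l h2l0, (contDiffOn_dv hls hD).div h2l h2l0,
      contDiffOn_mink (contDiffOn_du hs1 hD) hs2, contDiffOn_mink (contDiffOn_dv hs1 hD) hs2,
      hl, hcanon, fun p hp => left_ne_zero_of_mul (hflat p hp),
      fun p hp => right_ne_zero_of_mul (hflat p hp), fun p hp => ?_⟩,
    ⟨hz, hs1, hs2, fun p hp => ?_, fun p hp => ?_, fun p hp => ?_⟩⟩
  · have := hl0 p hp
    refine (hlp p hp).congr ?_ ?_ <;> simp only <;> field_simp
  · rw [frameField_apply]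
    exact isAdapted_of_isNormalBasis (hb p hp) (hE p hp) (hF p hp) (hG p hp)
  · have hx := hasPartials_of_contDiffOn hzu hD hp
    have hy := hasPartials_of_contDiffOn hzv hD hp
    have h1 := hasPartials_of_contDiffOn hs1 hD hp
    have h2 := hasPartials_of_contDiffOn hs2 hD hp
    rw [dv_du_eq_du_dv hz hD hp] at hx
    -- Differentiating the ten Gram relations of the frame in u and v, together with the known
    -- normal components of the second derivatives of z, gives every component of the derivatives of
    -- the frame.
    have gE := (hx.mink hx).congr_on (g := fun q => -lam q) hD hp fun q hq => (hE q hq).symm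
    have gG := (hy.mink hy).congr_on (g := lam) hD hp fun q hq => (hG q hq).symm
    have gF := (hx.mink hy).congr_on (g := fun _ => (0 : ℝ)) hD hp fun q hq => (hF q hq).symm
    have g1x := (h1.mink hx).congr_on (g := fun _ => (0 : ℝ)) hD hp
      fun q hq => (hb q hq).normal₁u.symm
    have g1y := (h1.mink hy).congr_on (g := fun _ => (0 : ℝ)) hD hp
      fun q hq => (hb q hq).normal₁v.symm
    have g2x := (h2.mink hx).congr_on (g := fun _ => (0 : ℝ)) hD hp
      fun q hq => (hb q hq).normal₂u.symm
    have g2y := (h2.mink hy).congr_on (g := fun _ => (0 : ℝ)) hD hp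
      fun q hq => (hb q hq).normal₂v.symm
    have g11 := (h1.mink h1).congr_on (g := fun _ => (1 : ℝ)) hD hp
      fun q hq => (hb q hq).unit₁.symm
    have g22 := (h2.mink h2).congr_on (g := fun _ => (1 : ℝ)) hD hp
      fun q hq => (hb q hq).unit₂.symm
    have g12 := (h1.mink h2).congr_on (g := fun _ => (0 : ℝ)) hD hp
      fun q hq => (hb q hq).orth.symm
    have c0 := HasPartials.const (0 : ℝ) p
    have c1 := HasPartials.const (1 : ℝ) p
    have EU := gE.du.symm.trans (hlp p hp).neg.du
    have EV := gE.dv.symm.trans (hlp p hp).neg.dv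
    have GU := gG.du.symm
    have GV := gG.dv.symm
    have FU := gF.du.symm.trans c0.du
    have FV := gF.dv.symm.trans c0.dv
    have XU1 := g1x.du.symm.trans c0.du
    have XV1 := g1x.dv.symm.trans c0.dv
    have YU1 := g1y.du.symm.trans c0.du
    have YV1 := g1y.dv.symm.trans c0.dv
    have XU2 := g2x.du.symm.trans c0.du
    have XV2 := g2x.dv.symm.trans c0.dv
    have YU2 := g2y.du.symm.trans c0.du
    have YV2 := g2y.dv.symm.trans c0.dv
    have U11 := g11.du.symm.trans c1.du
    have V11 := g11.dv.symm.trans c1.dv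
    have U22 := g22.du.symm.trans c1.du
    have V22 := g22.dv.symm.trans c1.dv
    have U12 := g12.du.symm.trans c0.du
    have V12 := g12.dv.symm.trans c0.dv
    have t1 := huu1 p hp
    have t2 := huu2 p hp
    have t3 := huv1 p hp
    have t4 := huv2 p hp
    have t5 := hvv1 p hp
    have t6 := hvv2 p hp
    rw [mink_comm (du z p)] at EU EV FU FV
    rw [mink_comm (dv z p)] at GU GV
    rw [mink_comm (n₁ p)] at XU1 XV1 YU1 YV1 U11 V11 U12 V12
    rw [mink_comm (n₂ p)] at XU2 XV2 YU2 YV2 U22 V22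
    have l0 := hl0 p hp
    have hexp := (isAdapted_of_isNormalBasis (hb p hp) (hE p hp) (hF p hp)
      (hG p hp)).expansion l0
    -- A vector is identified by its products with the adapted frame; the minus sign in the first
    -- condition is that of E = -λ.
    have hw : ∀ (w : R41) (x y s t : ℝ), mink w (du z p) = -(lam p * x) →
        mink w (dv z p) = lam p * y → mink w (n₁ p) = s → mink w (n₂ p) = t →
        w = x • du z p + (y • dv z p + (s • n₁ p + t • n₂ p)) := by
      intro w x y s t e1 e2 e3 e4
      conv_lhs => rw [hexp w]
      simp only [Fin.sum_univ_succ, eps, Matrix.cons_val_zero, Matrix.cons_val_succ,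
        Finset.univ_eq_empty, Finset.sum_empty, add_zero, e1, e2, e3, e4, div_one]
      rw [neg_div_neg_eq, mul_div_cancel_left₀ _ l0, mul_div_cancel_left₀ _ l0]
    intro i
    fin_cases i
    · refine hx.congr ?_ ?_ <;>
      · simp only [FrameData.matU, FrameData.matV, frameField, Fin.sum_univ_succ,
          Matrix.cons_val_zero, Matrix.cons_val_succ, Finset.univ_eq_empty, Finset.sum_empty,
          add_zero, Fin.zero_eta]
        refine hw _ _ _ _ _ ?_ ?_ ?_ ?_ <;> first | assumption | (field_simp; linarith)
    · refine hy.congr ?_ ?_ <;>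
      · simp only [FrameData.matU, FrameData.matV, frameField, Fin.sum_univ_succ,
          Matrix.cons_val_zero, Matrix.cons_val_succ, Finset.univ_eq_empty, Finset.sum_empty,
          add_zero, Fin.mk_one, Matrix.cons_val_one]
        refine hw _ _ _ _ _ ?_ ?_ ?_ ?_ <;> first | assumption | (field_simp; linarith)
    · refine h1.congr ?_ ?_ <;>
      · simp only [FrameData.matU, FrameData.matV, frameField, Fin.sum_univ_succ,
          Matrix.cons_val_zero, Matrix.cons_val_succ, Finset.univ_eq_empty, Finset.sum_empty,
          add_zero, Fin.reduceFinMk, Matrix.cons_val]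
        refine hw _ _ _ _ _ ?_ ?_ ?_ ?_ <;> first | rfl | linarith
    · refine h2.congr ?_ ?_ <;>
      · simp only [FrameData.matU, FrameData.matV, frameField, Fin.sum_univ_succ,
          Matrix.cons_val_zero, Matrix.cons_val_succ, Finset.univ_eq_empty, Finset.sum_empty,
          add_zero, Fin.reduceFinMk, Matrix.cons_val]
        refine hw _ _ _ _ _ ?_ ?_ ?_ ?_ <;> first | rfl | linarith
  · rw [frameField_apply]
    exact hc.frame.oriented p hp

end CanonicalSurfaces

/-! ### Existence, uniqueness up to motions, and the natural equations. -/

section FundamentalTheorem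

open Set Metric

variable {d : FrameData} {D : Set (ℝ × ℝ)} {z n₁ n₂ : ℝ × ℝ → R41} {K ϰ : ℝ × ℝ → ℝ}

theorem IsFrame.isIntegrable (h : IsFrame d D z n₁ n₂) (hd : d.IsRegular D) (hD : IsOpen D) :
    d.IsIntegrable D := by
  refine h.solution.isIntegrable hD hd (fun i => ?_) h.adapted
  fin_cases i
  exacts [contDiffOn_du h.smooth hD, contDiffOn_dv h.smooth hD, h.smooth₁, h.smooth₂]

theorem IsFrame.hasCurvatures (h : IsFrame d D z n₁ n₂) (hd : d.IsRegular D) (hD : IsOpen D)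
    (hi : d.IsIntegrable D) :
    d.HasCurvatures D (gaussCurvature z) (normalCurvature z n₁ n₂) := by
  refine ⟨fun p hp => h.gaussCurvature_eq hd hp, fun p hp => ?_⟩
  have h0 := (hd.lam_pos p hp).ne'
  rw [h.normalCurvature_eq hd hp hD, hi.ricci p hp]
  field_simp

/-- The natural equations of a surface in canonical parameters. -/
theorem IsCanonicalZMCSurface.natural_equations (h : IsCanonicalZMCSurface z D n₁ n₂)
    (hD : IsOpen D) :
    ContDiffOn ℝ ∞ (gaussCurvature z) D ∧ ContDiffOn ℝ ∞ (normalCurvature z n₁ n₂) D ∧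
      ∀ p ∈ D, normalCurvature z n₁ n₂ p ≠ 0 ∧
        NaturalEq₁ (gaussCurvature z) (normalCurvature z n₁ n₂) p ∧
        (gaussCurvature z p ≠ 0 →
          NaturalEq₂ (gaussCurvature z) (normalCurvature z n₁ n₂) p) := by
  obtain ⟨d, hd, hf⟩ := h.exists_isFrame hD
  have hi := hf.isIntegrable hd hD
  have hc := hf.hasCurvatures hd hD hi
  refine ⟨((hd.nu_smooth.pow 2).sub (hd.mu_smooth.pow 2)).congr hc.gauss_eq,
    ((contDiffOn_const.mul hd.nu_smooth).mul hd.mu_smooth).congr hc.normal_eq,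
    fun p hp => ⟨?_, (hc.naturalEq₁_iff hD hd hp).2 (hi.gauss p hp),
      fun hK => (hc.naturalEq₂_iff hD hd hi.toHasAngle hp hK).2 (hi.ricci p hp)⟩⟩
  rw [hc.normal_eq p hp]
  have := hd.nu_ne p hp
  have := hd.mu_ne p hp
  positivity

theorem FrameData.IsRegular.mono {D' : Set (ℝ × ℝ)} (hd : d.IsRegular D) (h : D' ⊆ D) :
    d.IsRegular D' :=
  ⟨hd.lam_smooth.mono h, hd.nu_smooth.mono h, hd.mu_smooth.mono h, hd.a_smooth.mono h,
    hd.b_smooth.mono h, hd.β₁_smooth.mono h, hd.β₂_smooth.mono h, fun p hp => hd.lam_pos p (h hp),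
    fun p hp => hd.canon p (h hp), fun p hp => hd.nu_ne p (h hp), fun p hp => hd.mu_ne p (h hp),
    fun p hp => hd.lam_partials p (h hp)⟩

theorem FrameData.IsIntegrable.mono {D' : Set (ℝ × ℝ)} (hi : d.IsIntegrable D) (h : D' ⊆ D) :
    d.IsIntegrable D' :=
  ⟨⟨fun p hp => hi.cos_partials p (h hp), fun p hp => hi.sin_partials p (h hp)⟩,
    fun p hp => hi.closed p (h hp), fun p hp => hi.gauss p (h hp),
    fun p hp => hi.ricci p (h hp)⟩

/-- A positively oriented adapted basis. -/
noncomputable def standardBasis (l : ℝ) : Fin 4 → R41 :=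
  -- The order of the vectors is an odd permutation of the coordinate axes; the minus sign makes the
  -- determinant +l.
  ![![0, 0, 0, -√l], ![√l, 0, 0, 0], ![0, 1, 0, 0], ![0, 0, 1, 0]]

theorem transition_standardBasis {l : ℝ} (hl : 0 < l) (w : R41) :
    transition l (standardBasis l) (standardBasis l) w = w := by
  have h2 := Real.mul_self_sqrt hl.le
  have h3 := hl.ne'
  have h4 : ∀ t : ℝ, t * √l / l * √l = t := fun t => by
    rw [div_mul_eq_mul_div, mul_assoc, h2, mul_div_cancel_right₀ _ h3]
  rw [transition_apply]
  ext k
  fin_cases k <;>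
    simp [Fin.sum_univ_four, standardBasis, mink, eps, h4, div_neg]

theorem det_standardBasis_pos {l : ℝ} (hl : 0 < l) :
    0 < (Matrix.of (standardBasis l)).det := by
  have h := Real.mul_self_sqrt hl.le
  have : (Matrix.of (standardBasis l)).det = l := by
    rw [← h]
    simp [standardBasis, Matrix.det_succ_row_zero, Fin.sum_univ_succ, Fin.succAbove]
    ring
  rwa [this]

/-- A solution of the derivation formulas with positively oriented adapted initial values remains
positively oriented and adapted. -/
theorem FrameData.IsSolution.adapted_and_oriented (hD : IsOpen D) (hDc : IsConnected D)
    (hd : d.IsRegular D) {X : Fin 4 → ℝ × ℝ → R41} (hX : d.IsSolution D X)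
    {p₀ : ℝ × ℝ} (hp₀ : p₀ ∈ D)
    (h₀ : ∀ w, transition (d.lam p₀) (fun i => X i p₀) (fun i => X i p₀) w = w)
    (hdet : 0 < (Matrix.of fun i => X i p₀).det) :
    ∀ p ∈ D, IsAdapted (d.lam p) (fun i => X i p) ∧ 0 < (Matrix.of fun i => X i p).det := by
  -- The transition operator from X to itself is constant on D and is the identity at `p₀`, so the
  -- expansion formula holds everywhere and characterises adapted frames.
  have had : ∀ p ∈ D, IsAdapted (d.lam p) fun i => X i p := fun p hp =>
    IsAdapted.of_expansion (hd.lam_pos p hp).ne' fun w =>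
      (eq_of_partials_eq_zero hD hDc (fun q hq => hX.hasPartials_transition hd hX w hq) hp
        hp₀).trans (h₀ w)
  have hcont : ContinuousOn (fun p => (Matrix.of fun i => X i p).det) D := by
    have hXc : ∀ i, ContinuousOn (X i) D := fun i q hq =>
      (hX q hq i).differentiableAt.continuousAt.continuousWithinAt
    have : ContinuousOn (fun p => Matrix.of fun i => X i p) D :=
      continuousOn_pi.2 fun i => hXc i
    exact (Continuous.matrix_det continuous_id).comp_continuousOn this
  have hne : ∀ p ∈ D, (Matrix.of fun i => X i p).det ≠ 0 := fun p hp h => by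
    have := (had p hp).det_sq
    rw [h] at this
    have h2 := hd.lam_pos p hp
    nlinarith
  refine fun p hp => ⟨had p hp, ?_⟩
  by_contra hneg
  -- The determinant has square λ², so on a connected domain it keeps its sign.
  obtain ⟨q, hq, hq0⟩ := hDc.isPreconnected.intermediate_value hp hp₀ hcont
    ⟨not_lt.1 hneg, hdet.le⟩
  exact hne q hq hq0

/-- Local existence of a canonical surface with given integrable coefficients. -/
theorem FrameData.IsIntegrable.exists_isFrame (hi : d.IsIntegrable D) (hD : IsOpen D)
    (hd : d.IsRegular D) {p₀ : ℝ × ℝ} (hp₀ : p₀ ∈ D) :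
    ∃ δ > 0, ball p₀ δ ⊆ D ∧ ∃ z n₁ n₂ : ℝ × ℝ → R41, IsFrame d (ball p₀ δ) z n₁ n₂ := by
  obtain ⟨δ, hδ, hsub, z, X, hX₀, hz, hXs, hzX, hX⟩ :=
    hi.exists_solution hD hd hp₀ (standardBasis (d.lam p₀))
  have hXe : (fun i => X i p₀) = standardBasis (d.lam p₀) := funext hX₀
  have hp := mem_ball_self (x := p₀) hδ
  have had := hX.adapted_and_oriented isOpen_ball
    ((convex_ball p₀ δ).isConnected ⟨p₀, hp⟩) (hd.mono hsub) hp
    (fun w => by rw [hXe]; exact transition_standardBasis (hd.lam_pos p₀ hp₀) w)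
    (by rw [hXe]; exact det_standardBasis_pos (hd.lam_pos p₀ hp₀))
  have hfr : ∀ i, EqOn (frameField z (X 2) (X 3) i) (X i) (ball p₀ δ) := by
    intro i q hq
    fin_cases i
    exacts [(hzX q hq).du, (hzX q hq).dv, rfl, rfl]
  have hfr' : ∀ q ∈ ball p₀ δ, (fun i => frameField z (X 2) (X 3) i q) = fun i => X i q :=
    fun q hq => funext fun i => hfr i hq
  refine ⟨δ, hδ, hsub, z, X 2, X 3, hz, hXs 2, hXs 3, fun q hq => ?_, fun q hq i => ?_,
    fun q hq => ?_⟩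
  · rw [hfr' q hq]; exact (had q hq).1
  · refine ((hX q hq i).congr_on isOpen_ball hq (hfr i)).congr ?_ ?_ <;>
      exact Finset.sum_congr rfl fun j _ => by rw [hfr j hq]
  · rw [hfr' q hq]; exact (had q hq).2

/-- Surfaces with equal coefficients of the derivation formulas differ by a motion. -/
theorem IsFrame.exists_motion {z' n₁' n₂' : ℝ × ℝ → R41} (hD : IsOpen D) (hDc : IsConnected D)
    (hd : d.IsRegular D) (h : IsFrame d D z n₁ n₂) (h' : IsFrame d D z' n₁' n₂') :
    ∃ φ : R41 → R41, IsMotion φ ∧ ∀ p ∈ D, z' p = φ (z p) := by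
  obtain ⟨p₀, hp₀⟩ := hDc.nonempty
  have hl := (hd.lam_pos p₀ hp₀).ne'
  obtain ⟨L, hL⟩ : ∃ L : R41 →ₗ[ℝ] R41, L = transition (d.lam p₀)
    (fun i => frameField z n₁ n₂ i p₀) fun i => frameField z' n₁' n₂' i p₀ := ⟨_, rfl⟩
  have hLX : ∀ p ∈ D, ∀ i, L (frameField z n₁ n₂ i p) = frameField z' n₁' n₂' i p := by
    -- The transition map at `p₀` is also the one at p, hence it carries the frame at p to the frame
    -- at p.
    intro p hp i
    rw [hL, eq_of_partials_eq_zero hD hDc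
      (fun q hq => h.solution.hasPartials_transition hd h'.solution _ hq) hp₀ hp]
    exact transition_basis (h.adapted p hp) (hd.lam_pos p hp).ne' i
  have hconst : ∀ p ∈ D, z' p - L (z p) = z' p₀ - L (z p₀) := fun p hp =>
    eq_of_partials_eq_zero (f := fun q => z' q - L (z q)) hD hDc (fun q hq =>
      ((hasPartials_of_contDiffOn h'.smooth hD hq).sub
        ((hasPartials_of_contDiffOn h.smooth hD hq).clm_comp L.toContinuousLinearMap)).congr
        (sub_eq_zero.2 (hLX q hq 0).symm) (sub_eq_zero.2 (hLX q hq 1).symm)) hp hp₀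
  refine ⟨fun x => L x + (z' p₀ - L (z p₀)), ⟨L, _, fun a b => ?_, ?_, fun x => rfl⟩,
    fun p hp => ?_⟩
  · rw [hL]
    exact mink_transition (h.adapted p₀ hp₀) (h'.adapted p₀ hp₀) hl a b
  · rw [hL]
    exact det_transition (h.adapted p₀ hp₀) (h'.adapted p₀ hp₀) hl (h.oriented p₀ hp₀)
      (h'.oriented p₀ hp₀)
  · simp [← hconst p hp]

/-- The frame with the opposite normal vectors. -/
theorem IsFrame.neg (h : IsFrame d D z n₁ n₂) :
    IsFrame { d with nu := fun q => -d.nu q, mu := fun q => -d.mu q } D z (fun q => -n₁ q)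
      (fun q => -n₂ q) := by
  refine ⟨h.smooth, h.smooth₁.neg, h.smooth₂.neg, fun p hp => ?_, fun p hp => ?_, fun p hp => ?_⟩
  · rw [frameField_apply]
    have hb := h.isNormalBasis hp
    refine isAdapted_of_isNormalBasis ⟨?_, ?_, ?_, ?_, ?_, ?_, ?_⟩ (h.EE_eq hp) (h.FF_eq hp)
      (h.GG_eq hp) <;>
      simp [mink_neg_left, mink_neg_right, hb.normal₁u, hb.normal₁v, hb.normal₂u, hb.normal₂v,
        hb.unit₁, hb.unit₂, hb.orth]
  · intro i
    fin_cases i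
    · refine (h.du_partials hp).congr ?_ ?_ <;>
        simp [FrameData.matU, FrameData.matV, frameField, Fin.sum_univ_four]
    · refine (h.dv_partials hp).congr ?_ ?_ <;>
        simp [FrameData.matU, FrameData.matV, frameField, Fin.sum_univ_four]
    · refine (h.n₁_partials hp).neg.congr ?_ ?_ <;>
        simp [FrameData.matU, FrameData.matV, frameField, Fin.sum_univ_four, add_comm]
    · refine (h.n₂_partials hp).neg.congr ?_ ?_ <;>
        simp [FrameData.matU, FrameData.matV, frameField, Fin.sum_univ_four, add_comm]
  -- Reversing two rows leaves the determinant unchanged.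
  · have h1 := h.oriented p hp
    rw [frameField_apply] at h1 ⊢
    convert h1 using 1
    simp [Matrix.det_succ_row_zero, Fin.sum_univ_succ, Fin.succAbove]

/-- a and b are read off the derivatives of λ; β₁ and β₂ off those of λν = cos θ, where sin θ = λμ ≠
0. So λ, ν, μ determine all coefficients. -/
theorem FrameData.HasAngle.eqOn {d' : FrameData} (hD : IsOpen D) (hd : d.IsRegular D)
    (hd' : d'.IsRegular D) (ha : d.HasAngle D) (ha' : d'.HasAngle D) (hlam : EqOn d'.lam d.lam D)
    (hnu : EqOn d'.nu d.nu D) (hmu : EqOn d'.mu d.mu D) :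
    EqOn d'.a d.a D ∧ EqOn d'.b d.b D ∧ EqOn d'.β₁ d.β₁ D ∧ EqOn d'.β₂ d.β₂ D := by
  have hl : ∀ p ∈ D, d.lam p ≠ 0 := fun p hp => (hd.lam_pos p hp).ne'
  have hc : ∀ p ∈ D, d.lam p * d.mu p ≠ 0 := fun p hp => mul_ne_zero (hl p hp) (hd.mu_ne p hp)
  have h1 : ∀ p ∈ D, HasPartials d'.lam _ _ p := fun p hp =>
    (hd.lam_partials p hp).congr_on hD hp hlam
  have h2 : ∀ p ∈ D, HasPartials (fun q => d'.lam q * d'.nu q) _ _ p := fun p hp =>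
    (ha.cos_partials p hp).congr_on hD hp fun q hq => by simp only [hlam hq, hnu hq]
  refine ⟨fun p hp => ?_, fun p hp => ?_, fun p hp => ?_, fun p hp => ?_⟩
  · have := (hd'.lam_partials p hp).du.symm.trans (h1 p hp).du
    rw [hlam hp] at this
    exact mul_left_cancel₀ (mul_ne_zero two_ne_zero (hl p hp)) this
  · have := (hd'.lam_partials p hp).dv.symm.trans (h1 p hp).dv
    rw [hlam hp] at this
    exact mul_left_cancel₀ (mul_ne_zero two_ne_zero (hl p hp)) this
  · have := (ha'.cos_partials p hp).dv.symm.trans (h2 p hp).dv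
    rw [hlam hp, hmu hp] at this
    exact mul_left_cancel₀ (hc p hp) (neg_injective this)
  · have := (ha'.cos_partials p hp).du.symm.trans (h2 p hp).du
    rw [hlam hp, hmu hp] at this
    exact mul_left_cancel₀ (hc p hp) (neg_injective this)

theorem IsFrame.congr {d' : FrameData} (hD : IsOpen D) (hd : d.IsRegular D)
    (hd' : d'.IsRegular D) (ha : d.HasAngle D) (h : IsFrame d' D z n₁ n₂)
    (hlam : EqOn d'.lam d.lam D) (hnu : EqOn d'.nu d.nu D) (hmu : EqOn d'.mu d.mu D) :
    IsFrame d D z n₁ n₂ := by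
  obtain ⟨e1, e2, e3, e4⟩ := ha.eqOn hD hd hd' (h.isIntegrable hd' hD).toHasAngle hlam hnu hmu
  refine ⟨h.smooth, h.smooth₁, h.smooth₂, fun p hp => hlam hp ▸ h.adapted p hp,
    fun p hp i => ?_, h.oriented⟩
  have hU : ∀ j, d'.matU i j p = d.matU i j p := by
    intro j
    fin_cases i <;> fin_cases j <;>
      simp [FrameData.matU, hlam hp, hnu hp, hmu hp, e1 hp, e2 hp, e3 hp]
  have hV : ∀ j, d'.matV i j p = d.matV i j p := by
    intro j
    fin_cases i <;> fin_cases j <;>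
      simp [FrameData.matV, hlam hp, hnu hp, hmu hp, e1 hp, e2 hp, e4 hp]
  simpa only [hU, hV] using h.solution p hp i

theorem FrameData.HasCurvatures.congr {K' ϰ' : ℝ × ℝ → ℝ} (h : d.HasCurvatures D K ϰ)
    (hK : EqOn K K' D) (hϰ : EqOn ϰ ϰ' D) : d.HasCurvatures D K' ϰ' :=
  ⟨fun p hp => hK hp ▸ h.gauss_eq p hp, fun p hp => hϰ hp ▸ h.normal_eq p hp⟩

theorem FrameData.HasCurvatures.lam_eqOn {d' : FrameData} (hd : d.IsRegular D)
    (hd' : d'.IsRegular D) (h : d.HasCurvatures D K ϰ) (h' : d'.HasCurvatures D K ϰ) :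
    EqOn d'.lam d.lam D := fun _ hp =>
  inv_injective ((h'.rpow_one_div_four hd' hp).symm.trans (h.rpow_one_div_four hd hp))

/-- ν² - μ² = K and ν² + μ² = λ⁻², where λ depends only on the curvatures. Only the sign of ν
remains open, and then ϰ = -2νμ fixes μ. -/
theorem FrameData.HasCurvatures.nu_sq_eq {d' : FrameData} (hd : d.IsRegular D)
    (hd' : d'.IsRegular D) (h : d.HasCurvatures D K ϰ) (h' : d'.HasCurvatures D K ϰ)
    {p : ℝ × ℝ} (hp : p ∈ D) : d'.nu p ^ 2 = d.nu p ^ 2 := by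
  have h1 := (h'.gauss_eq p hp).symm.trans (h.gauss_eq p hp)
  have h2 := (hd'.canon p hp).trans (hd.canon p hp).symm
  rw [h.lam_eqOn hd hd' h' hp] at h2
  have h3 := mul_left_cancel₀ (pow_ne_zero 2 (hd.lam_pos p hp).ne') h2
  linear_combination (h1 + h3) / 2

theorem IsFrame.exists_motion_of_curvatures_eq {d' : FrameData} {z' n₁' n₂' : ℝ × ℝ → R41}
    (hD : IsOpen D) (hDc : IsConnected D) (hd : d.IsRegular D) (hd' : d'.IsRegular D)
    (h : IsFrame d D z n₁ n₂) (h' : IsFrame d' D z' n₁' n₂') (hc : d.HasCurvatures D K ϰ)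
    (hc' : d'.HasCurvatures D K ϰ) (hpos : ∀ p ∈ D, 0 < d'.nu p * d.nu p) :
    ∃ φ : R41 → R41, IsMotion φ ∧ ∀ p ∈ D, z' p = φ (z p) := by
  have hnu : EqOn d'.nu d.nu D := fun p hp =>
    (sq_eq_sq_iff_eq_or_eq_neg.1 (hc.nu_sq_eq hd hd' hc' hp)).resolve_right fun hneg => by
      have h1 := hpos p hp
      rw [hneg] at h1
      nlinarith [sq_nonneg (d.nu p)]
  have hmu : EqOn d'.mu d.mu D := fun p hp => by
    have h1 := (hc'.normal_eq p hp).symm.trans (hc.normal_eq p hp)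
    rw [hnu hp] at h1
    exact mul_left_cancel₀ (mul_ne_zero (by norm_num) (hd.nu_ne p hp)) h1
  exact h.exists_motion hD hDc hd (h'.congr hD hd hd' (h.isIntegrable hd hD).toHasAngle
    (hc.lam_eqOn hd hd' hc') hnu hmu)

/-- Two surfaces in canonical parameters with the same curvatures differ by a motion. -/
theorem IsCanonicalZMCSurface.exists_motion {z' n₁' n₂' : ℝ × ℝ → R41} (hD : IsOpen D)
    (hDc : IsConnected D) (h : IsCanonicalZMCSurface z D n₁ n₂)
    (h' : IsCanonicalZMCSurface z' D n₁' n₂')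
    (hK : EqOn (gaussCurvature z') (gaussCurvature z) D)
    (hϰ : EqOn (normalCurvature z' n₁' n₂') (normalCurvature z n₁ n₂) D) :
    ∃ φ : R41 → R41, IsMotion φ ∧ ∀ p ∈ D, z' p = φ (z p) := by
  obtain ⟨d, hd, hf⟩ := h.exists_isFrame hD
  obtain ⟨d', hd', hf'⟩ := h'.exists_isFrame hD
  have hc := hf.hasCurvatures hd hD (hf.isIntegrable hd hD)
  have hc' := (hf'.hasCurvatures hd' hD (hf'.isIntegrable hd' hD)).congr hK hϰ
  have hcont : ContinuousOn (fun p => d'.nu p * d.nu p) D :=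
    hd'.nu_smooth.continuousOn.mul hd.nu_smooth.continuousOn
  have hne : ∀ p ∈ D, d'.nu p * d.nu p ≠ 0 := fun p hp =>
    mul_ne_zero (hd'.nu_ne p hp) (hd.nu_ne p hp)
  -- The product has no zeros on a connected domain, so its sign is constant. If it is negative,
  -- reversing both normals of the second surface, which changes neither z' nor the curvatures,
  -- reduces to the positive case.
  by_cases hpos : ∀ p ∈ D, 0 < d'.nu p * d.nu p
  · exact hf.exists_motion_of_curvatures_eq hD hDc hd hd' hf' hc hc' hpos
  · push Not at hpos
    obtain ⟨p, hp, hp0⟩ := hpos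
    have hneg : ∀ q ∈ D, 0 < -d'.nu q * d.nu q := by
      intro q hq
      by_contra hq0
      obtain ⟨r, hr, hr0⟩ := hDc.isPreconnected.intermediate_value hp hq hcont
        ⟨hp0, by linarith⟩
      exact hne r hr hr0
    refine hf.exists_motion_of_curvatures_eq hD hDc hd
      (d' := { d' with nu := fun q => -d'.nu q, mu := fun q => -d'.mu q }) ?_ hf'.neg hc ?_ hneg
    · exact { hd' with
        nu_smooth := hd'.nu_smooth.neg
        mu_smooth := hd'.mu_smooth.neg
        canon := fun q hq => by simpa using hd'.canon q hq
        nu_ne := fun q hq => neg_ne_zero.2 (hd'.nu_ne q hq)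
        mu_ne := fun q hq => neg_ne_zero.2 (hd'.mu_ne q hq) }
    · exact ⟨fun q hq => by simpa using hc'.gauss_eq q hq,
        fun q hq => by simpa using hc'.normal_eq q hq⟩

/-- Local existence of a surface in canonical parameters with given curvatures. -/
theorem exists_isCanonicalZMCSurface (hD : IsOpen D) (hK : ContDiffOn ℝ ∞ K D)
    (hϰ : ContDiffOn ℝ ∞ ϰ D) (hK0 : ∀ p ∈ D, K p ≠ 0) (hϰ0 : ∀ p ∈ D, ϰ p ≠ 0)
    (h₁ : ∀ p ∈ D, NaturalEq₁ K ϰ p) (h₂ : ∀ p ∈ D, NaturalEq₂ K ϰ p) {p₀ : ℝ × ℝ}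
    (hp₀ : p₀ ∈ D) :
    ∃ D₀ : Set (ℝ × ℝ), IsOpen D₀ ∧ IsConnected D₀ ∧ p₀ ∈ D₀ ∧ D₀ ⊆ D ∧
      ∃ z n₁ n₂ : ℝ × ℝ → R41, IsCanonicalZMCSurface z D₀ n₁ n₂ ∧
        (∀ p ∈ D₀, gaussCurvature z p = K p) ∧ ∀ p ∈ D₀, normalCurvature z n₁ n₂ p = ϰ p := by
  obtain ⟨d, hd, ha, hc, hclosed⟩ := exists_frameData hD hK hϰ hϰ0
  have hi : d.IsIntegrable D := ⟨ha, hclosed,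
    fun p hp => (hc.naturalEq₁_iff hD hd hp).1 (h₁ p hp),
    fun p hp => (hc.naturalEq₂_iff hD hd ha hp (hK0 p hp)).1 (h₂ p hp)⟩
  obtain ⟨δ, hδ, hsub, z, n₁, n₂, hf⟩ := hi.exists_isFrame hD hd hp₀
  have hp := mem_ball_self (x := p₀) hδ
  have hd' := hd.mono hsub
  have hc' := hf.hasCurvatures hd' isOpen_ball (hi.mono hsub)
  refine ⟨ball p₀ δ, isOpen_ball, (convex_ball p₀ δ).isConnected ⟨p₀, hp⟩, hp, hsub, z, n₁, n₂,
    hf.isCanonicalZMCSurface hd', fun p hp => ?_, fun p hp => ?_⟩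
  · rw [hc'.gauss_eq p hp, hc.gauss_eq p (hsub hp)]
  · rw [hc'.normal_eq p hp, hc.normal_eq p (hsub hp)]

end FundamentalTheorem

end TimelikeZMC

theorem mainTheorem2 :
    -- in canonical parameters the curvatures satisfy the natural equations
    (∀ (D : Set (ℝ × ℝ)) (z n₁ n₂ : ℝ × ℝ → TimelikeZMC.R41), IsOpen D →
      TimelikeZMC.IsCanonicalZMCSurface z D n₁ n₂ →
        ContDiffOn ℝ ∞ (TimelikeZMC.gaussCurvature z) D ∧
        ContDiffOn ℝ ∞ (TimelikeZMC.normalCurvature z n₁ n₂) D ∧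
        ∀ p ∈ D,
          TimelikeZMC.normalCurvature z n₁ n₂ p ≠ 0 ∧
          TimelikeZMC.NaturalEq₁ (TimelikeZMC.gaussCurvature z)
            (TimelikeZMC.normalCurvature z n₁ n₂) p ∧
          (TimelikeZMC.gaussCurvature z p ≠ 0 →
            TimelikeZMC.NaturalEq₂ (TimelikeZMC.gaussCurvature z)
              (TimelikeZMC.normalCurvature z n₁ n₂) p)) ∧
    -- conversely, a nonvanishing solution determines the surface up to a motion
    (∀ (D : Set (ℝ × ℝ)) (K ϰ : ℝ × ℝ → ℝ), IsOpen D → IsConnected D →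
      ContDiffOn ℝ ∞ K D → ContDiffOn ℝ ∞ ϰ D →
      (∀ p ∈ D, K p ≠ 0) → (∀ p ∈ D, ϰ p ≠ 0) →
      (∀ p ∈ D, TimelikeZMC.NaturalEq₁ K ϰ p) → (∀ p ∈ D, TimelikeZMC.NaturalEq₂ K ϰ p) →
        (∀ p₀ ∈ D, ∃ D₀ : Set (ℝ × ℝ), IsOpen D₀ ∧ IsConnected D₀ ∧ p₀ ∈ D₀ ∧ D₀ ⊆ D ∧
          ∃ z n₁ n₂ : ℝ × ℝ → TimelikeZMC.R41,
            TimelikeZMC.IsCanonicalZMCSurface z D₀ n₁ n₂ ∧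
            (∀ p ∈ D₀, TimelikeZMC.gaussCurvature z p = K p) ∧
            (∀ p ∈ D₀, TimelikeZMC.normalCurvature z n₁ n₂ p = ϰ p)) ∧
        (∀ D₀ : Set (ℝ × ℝ), IsOpen D₀ → IsConnected D₀ → D₀ ⊆ D →
          ∀ z n₁ n₂ z' n₁' n₂' : ℝ × ℝ → TimelikeZMC.R41,
            TimelikeZMC.IsCanonicalZMCSurface z D₀ n₁ n₂ →
            (∀ p ∈ D₀, TimelikeZMC.gaussCurvature z p = K p) →
            (∀ p ∈ D₀, TimelikeZMC.normalCurvature z n₁ n₂ p = ϰ p) →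
            TimelikeZMC.IsCanonicalZMCSurface z' D₀ n₁' n₂' →
            (∀ p ∈ D₀, TimelikeZMC.gaussCurvature z' p = K p) →
            (∀ p ∈ D₀, TimelikeZMC.normalCurvature z' n₁' n₂' p = ϰ p) →
            ∃ φ : TimelikeZMC.R41 → TimelikeZMC.R41, TimelikeZMC.IsMotion φ ∧
              ∀ p ∈ D₀, z' p = φ (z p))) := by
  refine ⟨fun D z n₁ n₂ hD h => h.natural_equations hD,
    fun D K ϰ hD _ hK hϰ hK0 hϰ0 h₁ h₂ => ⟨fun p₀ hp₀ =>
      TimelikeZMC.exists_isCanonicalZMCSurface hD hK hϰ hK0 hϰ0 h₁ h₂ hp₀,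
      fun D₀ hD₀ hD₀c _ z n₁ n₂ z' n₁' n₂' h hg hn h' hg' hn' =>
        h.exists_motion hD₀ hD₀c h' (fun p hp => (hg' p hp).trans (hg p hp).symm)
          fun p hp => (hn' p hp).trans (hn p hp).symm⟩⟩
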